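/- Conventions. Manifolds are smooth, finite-dimensional, without boundary, Hausdorff and second countable. For a finite-dimensional real vector space $V$, an element $u\in\Lambda^2V$ is regarded as an alternating bilinear form on $V^*$, and $u^\sharp:V^*\to V$ is defined by $\langle u^\sharp\alpha,\beta\rangle=u(\alpha,\beta)$; a $2$-vector field $\pi$ is nondegenerate if every $\pi_p^\sharp$ is an isomorphism, and is a Poisson structure if it is smooth with Schouten bracket $[\pi,\pi]=0$. A symplectic form $\omega$ induces the nondegenerate $2$-vector field $\pi$ with $\pi^\sharp=(v\mapsto\omega(v,\cdot))^{-1}$. Let $G$ be a connected Lie group with Lie algebra $\mathfrak g$ acting smoothly on a symplectic manifold $(M,\omega)$ by symplectomorphisms $\sigma_g$. For $X\in\mathfrak g$ let $X_M$ be the vector field $X_{M,p}=\frac{d}{ds}\big|_{s=0}\sigma_{\exp sX}(p)$, and for $u\in\Lambda^k\mathfrak g$ let $u_M$ be the induced $k$-vector field on $M$. Let $\mu:M\to\mathfrak g^*$ be a moment map: a smooth map with $d\langle\mu,X\rangle=\omega(X_M,\cdot)$ for all $X\in\mathfrak g$ and $\mu\circ\sigma_g=\mathrm{Ad}^*_g\circ\mu$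 for all $g\in G$, where $\langle \mathrm{Ad}_g^*\xi,X\rangle=\langle\xi,\mathrm{Ad}_{g^{-1}}X\rangle$. Let $\pi$ be the Poisson structure induced by $\omega$. For $t\in\Lambda^2\mathfrak g$ let $t^L,t^R$ be the left and right invariant $2$-vector fields on $G$ with value $t$ at the identity $e$, and put $[t,t]:=[t^L,t^L]_e\in\Lambda^3\mathfrak g$, $\pi_M^t:=\pi-t_M$ and $\pi_G^t:=t^L-t^R$. Call $t$ an r-matrix if $[t,t]$ is $\mathrm{ad}$-invariant. Let $D=T^*G\cong G\times\mathfrak g^*$ with product $(g,\xi)(h,\eta)=(gh,\xi+\mathrm{Ad}_g^*\eta)$, whose Lie algebra is $\mathfrak g\oplus\mathfrak g^*$, acting on $D/G\cong\mathfrak g^*$ by $(g,\xi)\cdot s=\xi+\mathrm{Ad}_g^*s$. The twisted complement $\mathfrak g^*_t=\{t^\sharp\xi+\xi:\xi\in\mathfrak g^*\}\subset\mathfrak g\oplus\mathfrak g^*$ is admissible at $s\in\mathfrak g^*$ if the infinitesimal action of $D$ at $s$ restricts to an isomorphism $\mathfrak g_t^*\to T_s\mathfrak g^*$. Then the following hold.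 (i) If $t\in\Lambda^2\mathfrak g$ satisfies $[t,t]_M=0$, then $\pi_M^t$ is a Poisson structure on $M$. If moreover $t$ is an r-matrix, then the action is a Poisson action of $(G,\pi_G^t)$ on $(M,\pi_M^t)$; that is, $\pi_G^t$ is a multiplicative Poisson structure on $G$ and the action map $G\times M\to M$ is a Poisson map for the product Poisson structure. (ii) If $t\in\Lambda^2\mathfrak g$ is such that $\mathfrak g_t^*$ is admissible at every point of $\mu(M)$, then $\pi_M^t$ is a nondegenerate smooth $2$-vector field. If $M$ is compact, then $\pi_M^t$ is a nondegenerate smooth $2$-vector field for all $t$ in some neighbourhood of $0$ in $\Lambda^2\mathfrak g$. Consequently, if $[t,t]_M=0$ and either $\mathfrak g_t^*$ is admissible at every point of $\mu(M)$, or $M$ is compact and $t$ lies in a suitable neighbourhood of $0$ (independent of the condition $[t,t]_M=0$), then there is a unique symplectic form $\omega^t$ on $M$ whose induced $2$-vector field is $\pi_M^t$. -/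

import Mathlib

open scoped Manifold ContDiff Topology

noncomputable section

namespace TwistDeformation

/-! ### Linear algebra of multivectors and two-forms -/

section LinearAlgebra

variable {k : ℕ} {V W : Type*}
  [AddCommGroup V] [Module ℝ V] [TopologicalSpace V]
  [AddCommGroup W] [Module ℝ W] [TopologicalSpace W]

/-- `Λᵏ V` for a finite-dimensional real vector space `V`, realised as the space of alternating
`k`-linear forms on the dual `V*`; `v₁ ∧ ⋯ ∧ vₖ` is the form `(α₁, …, αₖ) ↦ det (αᵢ vⱼ)`. -/
abbrev Multivector (k : ℕ) (V : Type*) [AddCommGroup V] [Module ℝ V] [TopologicalSpace V] :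
    Type _ :=
  (V →L[ℝ] ℝ) [⋀^Fin k]→L[ℝ] ℝ

/-- The map `Λᵏ L : Λᵏ V → Λᵏ W` induced by a linear map `L : V → W`:
`(Λᵏ L) u (α₁, …, αₖ) = u (α₁ ∘ L, …, αₖ ∘ L)`. -/
def Multivector.push (L : V →L[ℝ] W) (u : Multivector k V) : Multivector k W :=
  u.compContinuousLinearMap (L.precomp ℝ)

theorem map_pair_add_left (w : V [⋀^Fin 2]→L[ℝ] ℝ) (a b c : V) :
    w ![a + b, c] = w ![a, c] + w ![b, c] := by
  have h := w.map_update_add ![0, c] 0 a b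
  have e : ∀ x : V, Function.update ![0, c] 0 x = ![x, c] := fun x => by
    ext i; fin_cases i <;> rfl
  rwa [e, e, e] at h

theorem map_pair_smul_left (w : V [⋀^Fin 2]→L[ℝ] ℝ) (r : ℝ) (a c : V) :
    w ![r • a, c] = r • w ![a, c] := by
  have h := w.map_update_smul ![0, c] 0 r a
  have e : ∀ x : V, Function.update ![0, c] 0 x = ![x, c] := fun x => by
    ext i; fin_cases i <;> rfl
  rwa [e, e] at h

theorem map_pair_add_right (w : V [⋀^Fin 2]→L[ℝ] ℝ) (a b c : V) :
    w ![a, b + c] = w ![a, b] + w ![a, c] := by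
  have h := w.map_update_add ![a, 0] 1 b c
  have e : ∀ x : V, Function.update ![a, 0] 1 x = ![a, x] := fun x => by
    ext i; fin_cases i <;> rfl
  rwa [e, e, e] at h

theorem map_pair_smul_right (w : V [⋀^Fin 2]→L[ℝ] ℝ) (r : ℝ) (a b : V) :
    w ![a, r • b] = r • w ![a, b] := by
  have h := w.map_update_smul ![a, 0] 1 r b
  have e : ∀ x : V, Function.update ![a, 0] 1 x = ![a, x] := fun x => by
    ext i; fin_cases i <;> rfl
  rwa [e, e] at h

theorem map_pair_swap (w : V [⋀^Fin 2]→L[ℝ] ℝ) (a b : V) : w ![a, b] = -w ![b, a] := by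
  have h : w ![a + b, a + b] = 0 :=
    w.map_eq_zero_of_eq ![a + b, a + b] (i := 0) (j := 1) rfl (by decide)
  have ha : w ![a, a] = 0 := w.map_eq_zero_of_eq ![a, a] (i := 0) (j := 1) rfl (by decide)
  have hb : w ![b, b] = 0 := w.map_eq_zero_of_eq ![b, b] (i := 0) (j := 1) rfl (by decide)
  rw [map_pair_add_left, map_pair_add_right, map_pair_add_right, ha, hb] at h
  linarith

variable [IsTopologicalAddGroup V] [ContinuousSMul ℝ V] [T2Space V] [FiniteDimensional ℝ V]

/-- The map `u♯ : V* → V` of a bivector `u`, characterised by `⟨u♯ α, β⟩ = u (α, β)`. -/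
def Multivector.sharp (u : Multivector 2 V) : (V →L[ℝ] ℝ) →ₗ[ℝ] V where
  toFun α := (Module.evalEquiv ℝ V).symm
    { toFun := fun β => u ![α, LinearMap.toContinuousLinearMap β]
      map_add' := fun β γ => by rw [map_add, map_pair_add_right]
      map_smul' := fun c β => by rw [map_smul, map_pair_smul_right, RingHom.id_apply] }
  map_add' α β := by
    rw [← map_add]
    congr 1
    ext γ
    exact map_pair_add_left u α β (LinearMap.toContinuousLinearMap γ)
  map_smul' c α := by
    rw [RingHom.id_apply, ← map_smul]
    congr 1
    ext γ
    exact map_pair_smul_left u c α (LinearMap.toContinuousLinearMap γ)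

theorem Multivector.apply_sharp (u : Multivector 2 V) (α β : V →L[ℝ] ℝ) :
    β (u.sharp α) = u ![α, β] := by
  have h : (β : Module.Dual ℝ V) (u.sharp α) =
      (Module.evalEquiv ℝ V) (u.sharp α) (β : Module.Dual ℝ V) := rfl
  have h2 : (β : Module.Dual ℝ V) (u.sharp α) = β (u.sharp α) := rfl
  rw [← h2, h]
  simp only [Multivector.sharp, LinearMap.coe_mk, AddHom.coe_mk, LinearEquiv.apply_symm_apply]
  congr 2

/-- A bivector `u` is nondegenerate if `u♯ : V* → V` is an isomorphism. -/
def Multivector.Nondegenerate (u : Multivector 2 V) : Prop :=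
  Function.Bijective u.sharp

/-- The map `w♭ : V → V*`, `w♭ v = w (v, ·)`, of an alternating two-form `w`. -/
def flat (w : V [⋀^Fin 2]→L[ℝ] ℝ) : V →L[ℝ] (V →L[ℝ] ℝ) :=
  LinearMap.toContinuousLinearMap
    { toFun := fun v => LinearMap.toContinuousLinearMap
        { toFun := fun x => w ![v, x]
          map_add' := fun x y => map_pair_add_right w v x y
          map_smul' := fun c x => map_pair_smul_right w c v x }
      map_add' := fun v v' => by
        ext x
        exact map_pair_add_left w v v' x
      map_smul' := fun c v => by
        ext x
        exact map_pair_smul_left w c v x }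

theorem flat_apply (w : V [⋀^Fin 2]→L[ℝ] ℝ) (v x : V) : flat w v x = w ![v, x] :=
  rfl

/-- The bivector induced by a nondegenerate two-form `w`. It is the bivector `u` with
`u♯ = (w♭)⁻¹`, that is `u (w♭ v, w♭ v') = w♭ v' (v) = - w (v, v')`. -/
def inducedBivector (w : V [⋀^Fin 2]→L[ℝ] ℝ) : Multivector 2 V :=
  -(w.compContinuousLinearMap (flat w).inverse)

theorem sharp_inducedBivector (w : V [⋀^Fin 2]→L[ℝ] ℝ) (hw : (flat w).IsInvertible) (v : V) :
    (inducedBivector w).sharp (flat w v) = v := by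
  have hi : ∀ x, (flat w).inverse (flat w x) = x := fun x => hw.inverse_apply_eq.2 rfl
  have key : ∀ x : V, flat w x ((inducedBivector w).sharp (flat w v)) = flat w x v := fun x => by
    rw [Multivector.apply_sharp, inducedBivector, flat_apply, map_pair_swap w x v]
    change -(w (fun i => (flat w).inverse (![flat w v, flat w x] i))) = _
    congr 2
    ext i; fin_cases i <;> simp [hi]
  rw [← hi ((inducedBivector w).sharp (flat w v))]
  conv_rhs => rw [← hi v]
  congr 1
  ext x
  rw [flat_apply, flat_apply, map_pair_swap, map_pair_swap w v, ← flat_apply, ← flat_apply, key]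

end LinearAlgebra

/-! ### Forms and multivector fields on a manifold -/

section Manifold

variable {E : Type*} [NormedAddCommGroup E] [NormedSpace ℝ E]
  {M : Type*} [TopologicalSpace M] [ChartedSpace E M]

instance instFiniteDimensionalTangentSpace [FiniteDimensional ℝ E] (p : M) :
    FiniteDimensional ℝ (TangentSpace 𝓘(ℝ, E) p) :=
  inferInstanceAs (FiniteDimensional ℝ E)

instance instT2SpaceTangentSpace (p : M) : T2Space (TangentSpace 𝓘(ℝ, E) p) :=
  inferInstanceAs (T2Space E)

variable (E M) in
/-- (Not necessarily smooth) fields of `k`-vectors on `M`. -/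
abbrev MultivectorField (k : ℕ) : Type _ :=
  ∀ p : M, Multivector k (TangentSpace 𝓘(ℝ, E) p)

variable (E M) in
/-- (Not necessarily smooth) differential `k`-forms on `M`. -/
abbrev FormField (k : ℕ) : Type _ :=
  ∀ p : M, TangentSpace 𝓘(ℝ, E) p [⋀^Fin k]→L[ℝ] ℝ

/-- The expression of a `k`-form in the chart at `x₀`: its pullback by the inverse chart. -/
def FormField.inChart {k : ℕ} (w : FormField E M k) (x₀ : M) : E → E [⋀^Fin k]→L[ℝ] ℝ := fun y =>
  (w ((extChartAt 𝓘(ℝ, E) x₀).symm y)).compContinuousLinearMap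
    (mfderiv 𝓘(ℝ, E) 𝓘(ℝ, E) (extChartAt 𝓘(ℝ, E) x₀).symm y)

/-- Smoothness of a differential form. -/
def FormField.IsSmooth {k : ℕ} (w : FormField E M k) : Prop :=
  ∀ x₀ : M, ContDiffOn ℝ ∞ (w.inChart x₀) (extChartAt 𝓘(ℝ, E) x₀).target

/-- Closedness of a differential form: its exterior derivative vanishes in every chart. -/
def FormField.IsClosed {k : ℕ} (w : FormField E M k) : Prop :=
  ∀ x₀ : M, ∀ y ∈ (extChartAt 𝓘(ℝ, E) x₀).target, extDeriv (w.inChart x₀) y = 0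

/-- A symplectic form: a smooth, closed, pointwise nondegenerate two-form. -/
structure IsSymplectic (w : FormField E M 2) : Prop where
  smooth : w.IsSmooth
  closed : w.IsClosed
  nondegenerate : ∀ (p : M) (v : TangentSpace 𝓘(ℝ, E) p),
    (∀ v' : TangentSpace 𝓘(ℝ, E) p, w p ![v, v'] = 0) → v = 0

/-- The expression of a `k`-vector field in the chart at `x₀`: its pushforward by the chart. -/
def MultivectorField.inChart {k : ℕ} (u : MultivectorField E M k) (x₀ : M) :
    E → Multivector k E := fun y =>
  Multivector.push
    (mfderiv 𝓘(ℝ, E) 𝓘(ℝ, E) (extChartAt 𝓘(ℝ, E) x₀) ((extChartAt 𝓘(ℝ, E) x₀).symm y))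
    (u ((extChartAt 𝓘(ℝ, E) x₀).symm y))

/-- Smoothness of a multivector field. -/
def MultivectorField.IsSmooth {k : ℕ} (u : MultivectorField E M k) : Prop :=
  ∀ x₀ : M, ContDiffOn ℝ ∞ (u.inChart x₀) (extChartAt 𝓘(ℝ, E) x₀).target

variable [FiniteDimensional ℝ E]

/-- The Schouten bracket `[P, P]` of a bivector field `P` on the vector space `E` with itself:
for constant one-forms `α, β, γ` it is twice the cyclic sum of
`(∂_{P♯ α} P) (β, γ)`. In coordinates,
`[P, P]^{ijk} = 2 ∑ₗ (P^{il} ∂ₗ P^{jk} + P^{jl} ∂ₗ P^{ki} + P^{kl} ∂ₗ P^{ij})`. -/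
def schoutenSelfE (P : E → Multivector 2 E) (y : E) : Multivector 3 E :=
  (2 : ℝ) • ContinuousAlternatingMap.alternatizeUncurryFin
    ((fderiv ℝ P y).comp (LinearMap.toContinuousLinearMap (P y).sharp))

/-- The Schouten bracket `[P, P]` of a bivector field `P` on `M` with itself. -/
def schoutenSelf (P : MultivectorField E M 2) : MultivectorField E M 3 := fun p =>
  Multivector.push (V := E)
    (mfderiv 𝓘(ℝ, E) 𝓘(ℝ, E) (extChartAt 𝓘(ℝ, E) p).symm (extChartAt 𝓘(ℝ, E) p p))
    (schoutenSelfE (P.inChart p) (extChartAt 𝓘(ℝ, E) p p))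

/-- A Poisson structure: a smooth bivector field `P` with `[P, P] = 0`. -/
structure IsPoisson (P : MultivectorField E M 2) : Prop where
  smooth : P.IsSmooth
  schouten_eq_zero : ∀ p : M, schoutenSelf P p = 0

/-- A nondegenerate (smooth) bivector field. -/
structure IsNondegenerate (P : MultivectorField E M 2) : Prop where
  smooth : P.IsSmooth
  nondegenerate : ∀ p : M, (P p).Nondegenerate

/-- The bivector field `π` induced by a symplectic form `w`, with `π♯ = (w♭)⁻¹`. -/
def inducedPoisson (w : FormField E M 2) : MultivectorField E M 2 := fun p =>
  inducedBivector (w p)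

end Manifold

/-! ### Lie groups and twists -/

section LieGroup

variable {F : Type*} [NormedAddCommGroup F] [NormedSpace ℝ F]
  {G : Type*} [TopologicalSpace G] [ChartedSpace F G] [Group G]

variable (F G) in
/-- The Lie algebra `𝔤` of `G`. -/
abbrev LieAlg : Type _ := GroupLieAlgebra 𝓘(ℝ, F) G

variable (F G) in
/-- The dual `𝔤*` of the Lie algebra of `G`. -/
abbrev LieDual : Type _ := LieAlg F G →L[ℝ] ℝ

/-- The left invariant multivector field `u^L` with value `u` at the identity. -/
def leftInv {k : ℕ} (u : Multivector k (LieAlg F G)) : MultivectorField F G k := fun g =>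
  Multivector.push (mfderiv 𝓘(ℝ, F) 𝓘(ℝ, F) (fun h : G => g * h) 1) u

/-- The right invariant multivector field `u^R` with value `u` at the identity. -/
def rightInv {k : ℕ} (u : Multivector k (LieAlg F G)) : MultivectorField F G k := fun g =>
  Multivector.push (mfderiv 𝓘(ℝ, F) 𝓘(ℝ, F) (fun h : G => h * g) 1) u

/-- The adjoint action `Ad_g : 𝔤 → 𝔤`. -/
def Ad (g : G) : LieAlg F G →L[ℝ] LieAlg F G :=
  mfderiv 𝓘(ℝ, F) 𝓘(ℝ, F) (fun h : G => g * h * g⁻¹) 1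

/-- The coadjoint action `Ad*_g : 𝔤* → 𝔤*`, `⟨Ad*_g η, X⟩ = ⟨η, Ad_{g⁻¹} X⟩`. -/
def coAd (g : G) (η : LieDual F G) : LieDual F G :=
  η.comp (Ad g⁻¹)

/-- The multiplication of the group `D = T*G ≅ G × 𝔤*`, the semidirect product for the coadjoint
action: `(g, ξ) (h, η) = (g h, ξ + Ad*_g η)`. Its identity is `(1, 0)` and its Lie algebra is
`𝔡 = 𝔤 ⊕ 𝔤*`. -/
def cotangentMul (a b : G × LieDual F G) : G × LieDual F G :=
  (a.1 * b.1, a.2 + coAd a.1 b.2)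

/-- The dressing action of `D` on `D / G ≅ 𝔤*`, induced by left multiplication. The
identification `D / G ≅ 𝔤*` is induced by the projection `D → 𝔤*`, whose fibres are the cosets of
`G = G × {0}`, so that `s` is the class of `(1, s)`. -/
def dressing (a : G × LieDual F G) (s : LieDual F G) : LieDual F G :=
  (cotangentMul a (1, s)).2

/-- The infinitesimal dressing action `𝔡 = 𝔤 ⊕ 𝔤* → T_s (D / G) = 𝔤*`, i.e. the derivative at the
identity `(1, 0)` of `D` of the orbit map of `s`. -/
def infinitesimalDressing (s : LieDual F G) :
    LieAlg F G × LieDual F G →L[ℝ] LieDual F G :=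
  mfderiv (M := G × (F →L[ℝ] ℝ)) (M' := F →L[ℝ] ℝ)
    (𝓘(ℝ, F).prod 𝓘(ℝ, F →L[ℝ] ℝ)) 𝓘(ℝ, F →L[ℝ] ℝ)
    (fun a => dressing (F := F) (G := G) a s) (1, 0)

variable [FiniteDimensional ℝ F]

/-- The complement `𝔤*_t` of `𝔤` in `𝔡 = 𝔤 ⊕ 𝔤*` obtained from `𝔤*` by the twist `t`:
`𝔤*_t = {t♯ ξ + ξ | ξ ∈ 𝔤*}`. -/
def twistedComplement (t : Multivector 2 (LieAlg F G)) :
    Submodule ℝ (LieAlg F G × LieDual F G) :=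
  LinearMap.range (t.sharp.prod LinearMap.id)

/-- `𝔤*_t` is admissible at `s ∈ D / G ≅ 𝔤*`: the infinitesimal dressing action restricts to an
isomorphism from `𝔤*_t` onto `T_s (D / G)`. -/
def IsAdmissibleAt (t : Multivector 2 (LieAlg F G)) (s : LieDual F G) : Prop :=
  Function.Bijective fun x : twistedComplement t => infinitesimalDressing s (x : _ × _)

/-- The element `[t, t] = [t^L, t^L]_e` of `Λ³ 𝔤`. -/
def twistBracket (t : Multivector 2 (LieAlg F G)) : Multivector 3 (LieAlg F G) :=
  schoutenSelf (leftInv t) 1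

/-- The adjoint map `ad_X : 𝔤 → 𝔤`, `Y ↦ [X, Y]`. -/
def ad [LieGroup 𝓘(ℝ, F) ∞ G] (X : LieAlg F G) : LieAlg F G →L[ℝ] LieAlg F G :=
  haveI : LieGroup 𝓘(ℝ, F) (minSmoothness ℝ 3) G :=
    LieGroup.of_le (m := minSmoothness ℝ 3) (n := ∞) (by
      rw [minSmoothness_of_isRCLikeNormedField]; exact WithTop.coe_le_coe.2 le_top)
  LinearMap.toContinuousLinearMap (LieAlgebra.ad ℝ (LieAlg F G) X : LieAlg F G →ₗ[ℝ] LieAlg F G)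

/-- `u ∈ Λᵏ 𝔤` is `ad`-invariant: `ad_X u = 0` for all `X`, where
`(ad_X u) (ξ₁, …, ξₖ) = ∑ᵢ u (ξ₁, …, ξᵢ ∘ ad_X, …, ξₖ)`. -/
def IsAdInvariant [LieGroup 𝓘(ℝ, F) ∞ G] {k : ℕ} (u : Multivector k (LieAlg F G)) : Prop :=
  ∀ (X : LieAlg F G) (ξ : Fin k → LieDual F G),
    ∑ i, u (Function.update ξ i ((ξ i).comp (ad X))) = 0

/-- `t ∈ Λ² 𝔤` is an r-matrix: `[t, t]` is `ad`-invariant. -/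
def IsRMatrix [LieGroup 𝓘(ℝ, F) ∞ G] (t : Multivector 2 (LieAlg F G)) : Prop :=
  IsAdInvariant (twistBracket t)

/-- `(G, P)` is a Poisson Lie group: `P` is a Poisson structure that is multiplicative,
`P_{gh} = L_{g*} P_h + R_{h*} P_g`. -/
structure IsPoissonLieGroup (P : MultivectorField F G 2) : Prop where
  poisson : IsPoisson P
  multiplicative : ∀ g h : G,
    P (g * h) = Multivector.push (mfderiv 𝓘(ℝ, F) 𝓘(ℝ, F) (fun x : G => g * x) h) (P h)
      + Multivector.push (mfderiv 𝓘(ℝ, F) 𝓘(ℝ, F) (fun x : G => x * h) g) (P g)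

end LieGroup

/-! ### Actions -/

section Action

variable {E : Type*} [NormedAddCommGroup E] [NormedSpace ℝ E]
  {M : Type*} [TopologicalSpace M] [ChartedSpace E M]
  {F : Type*} [NormedAddCommGroup F] [NormedSpace ℝ F]
  {G : Type*} [TopologicalSpace G] [ChartedSpace F G] [Group G] [MulAction G M]

/-- The infinitesimal action `𝔤 → T_p M`, `X ↦ X_{M,p} = d/ds (exp (sX) • p)` at `s = 0`, i.e. the
derivative at the identity of the orbit map of `p`. -/
def infinitesimalAction (p : M) : LieAlg F G →L[ℝ] TangentSpace 𝓘(ℝ, E) p :=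
  mfderiv 𝓘(ℝ, F) 𝓘(ℝ, E) (fun g : G => g • p) 1

variable (E M) in
/-- The fundamental multivector field `u_M` of `u ∈ Λᵏ 𝔤`. -/
def fundamental {k : ℕ} (u : Multivector k (LieAlg F G)) : MultivectorField E M k := fun p =>
  Multivector.push (infinitesimalAction p) u

variable (G) in
/-- The action of `G` preserves the two-form `w`: `σ_g^* w = w` for all `g`. -/
def PreservesForm (w : FormField E M 2) : Prop :=
  ∀ (g : G) (p : M),
    (w (g • p)).compContinuousLinearMap (mfderiv 𝓘(ℝ, E) 𝓘(ℝ, E) (fun q : M => g • q) p) = w p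

/-- `μ : M → 𝔤*` is a moment map for the action of `G` on `(M, w)`: it is smooth, satisfies
`d μ^X = ι_{X_M} w` where `μ^X = ⟨μ, X⟩`, and is equivariant for the coadjoint action. -/
structure IsMomentMap (w : FormField E M 2) (μ : M → LieDual F G) : Prop where
  smooth : ∀ X : LieAlg F G, ContMDiff 𝓘(ℝ, E) 𝓘(ℝ, ℝ) ∞ fun p => μ p X
  hamiltonian : ∀ (X : LieAlg F G) (p : M) (v : TangentSpace 𝓘(ℝ, E) p),
    mfderiv 𝓘(ℝ, E) 𝓘(ℝ, ℝ) (fun q => μ q X) p v = w p ![infinitesimalAction p X, v]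
  equivariant : ∀ (g : G) (p : M), μ (g • p) = coAd g (μ p)

/-- The deformation `π - t_M` of the bivector field `π` by the twist `t`. -/
def deform (P : MultivectorField E M 2) (t : Multivector 2 (LieAlg F G)) :
    MultivectorField E M 2 := fun p =>
  P p - fundamental E M t p

variable [FiniteDimensional ℝ E] [FiniteDimensional ℝ F]

/-- The action `σ : G × M → M` is a Poisson action of the Poisson Lie group `(G, PG)` on the
Poisson manifold `(M, PM)`: `σ` is a Poisson map for the product Poisson structure on `G × M`, i.e.
`PM_{g p} = (σ_g)_* PM_p + (σ^p)_* PG_g` with `σ_g = (g • ·)` and `σ^p = (· • p)`. -/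
structure IsPoissonAction (PG : MultivectorField F G 2) (PM : MultivectorField E M 2) : Prop where
  group : IsPoissonLieGroup PG
  manifold : IsPoisson PM
  map : ∀ (g : G) (p : M),
    PM (g • p) = Multivector.push (mfderiv 𝓘(ℝ, E) 𝓘(ℝ, E) (fun q : M => g • q) p) (PM p)
      + Multivector.push (mfderiv 𝓘(ℝ, F) 𝓘(ℝ, E) (fun h : G => h • p) g) (PG g)

end Action

end TwistDeformation

end

open TwistDeformation

/-!
The bracket identities rest on the naturality of the Schouten bracket: if a smooth map relates a
bivector field `P` to `Q`, it relates `[P, P]` to `[Q, Q]`, and likewise for a smooth map on a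
product that relates the product of two bivector fields to a third one
(`schoutenSelf_related`, `schoutenSelf_related_prod`). For an invariant bivector field `P` on `M`
the action map `G × M → M` relates the product of `-t^R` and `P` to `P - t_M`, because the orbit
maps send `t^R` to `t_M`. As `[t^R, t^R]_e = -[t, t]` by naturality under the inversion of `G`, this
gives `[P - t_M, P - t_M] = [P, P] - [t, t]_M` (`schoutenSelf_deform`). For `P` induced by an
invariant symplectic form the first term vanishes, and the condition `[t, t]_M = 0` makes
`P - t_M` Poisson. The same identity for `P = t^L` and the action of `G` on itself by left
translations, whose fundamental fields are the right invariant ones, shows that `t^L - t^R` has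
bracket `[t, t]^L - [t, t]^R`. This vanishes for an r-matrix, since on a connected group
`ad`-invariance integrates to `Ad`-invariance (`IsAdInvariant.push_Ad`); the derivative of `Ad` at
the identity is computed in the chart there (`fderiv_chartAd_eq_ad`).

For the nondegeneracy let `ρ : 𝔤 → T_p M` be the infinitesimal action and `π♯ = (w♭)⁻¹`. Then
`w♭ (π - t_M)♯ = 1 - a b` with `a = w♭ ρ t♯` and `b = ρ*`, and `1 - a b` is invertible as soon as
`1 - b a` is. Infinitesimal equivariance of the moment map identifies `b a = ρ* w♭ ρ t♯` with
`ξ ↦ μ(p) ∘ ad (t♯ ξ)`, so that `1 - b a` is the infinitesimal dressing action at `μ(p)` restricted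
to the twisted complement (`IsMomentMap.isNondegenerate_deform`). If `M` is compact, this operator
is close to the identity uniformly in `p` for small `t`.

Finally, a nondegenerate Poisson structure is induced by a unique symplectic form, because the
Schouten bracket of a nondegenerate bivector field corresponds under `♯` to the exterior derivative
of the inverse two-form (`schoutenSelfE_eq_extDeriv`, `existsUnique_isSymplectic`).
-/

namespace TwistDeformation

/-! ### Bivectors, two-forms and their sharp and flat maps -/

section LinearAlgebraLemmas

variable {k : ℕ} {V W : Type*}
  [AddCommGroup V] [Module ℝ V] [TopologicalSpace V]
  [AddCommGroup W] [Module ℝ W] [TopologicalSpace W]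

theorem pair_ext {w w' : V [⋀^Fin 2]→L[ℝ] ℝ} (h : ∀ a b, w ![a, b] = w' ![a, b]) : w = w' := by
  ext v
  have e : v = ![v 0, v 1] := by ext i; fin_cases i <;> rfl
  rw [e, h]

theorem triple_ext {w w' : V [⋀^Fin 3]→L[ℝ] ℝ}
    (h : ∀ a b c, w ![a, b, c] = w' ![a, b, c]) : w = w' := by
  ext v
  have e : v = ![v 0, v 1, v 2] := by ext i; fin_cases i <;> rfl
  rw [e, h]

theorem comp_pair (w : V [⋀^Fin 2]→L[ℝ] ℝ) (L : W →L[ℝ] V) (a b : W) :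
    w.compContinuousLinearMap L ![a, b] = w ![L a, L b] := by
  change w (fun i => L (![a, b] i)) = _
  congr 1
  ext i; fin_cases i <;> rfl

theorem Multivector.push_apply (L : V →L[ℝ] W) (u : Multivector k V) (ξ : Fin k → W →L[ℝ] ℝ) :
    Multivector.push L u ξ = u fun i => (ξ i).comp L :=
  rfl

theorem Multivector.push_pair (L : V →L[ℝ] W) (u : Multivector 2 V) (α β : W →L[ℝ] ℝ) :
    Multivector.push L u ![α, β] = u ![α.comp L, β.comp L] := by
  rw [Multivector.push_apply]
  congr 1
  ext i; fin_cases i <;> rfl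

theorem Multivector.push_triple (L : V →L[ℝ] W) (u : Multivector 3 V) (α β γ : W →L[ℝ] ℝ) :
    Multivector.push L u ![α, β, γ] = u ![α.comp L, β.comp L, γ.comp L] := by
  rw [Multivector.push_apply]
  congr 1
  ext i; fin_cases i <;> rfl

theorem Multivector.push_sub (L : V →L[ℝ] W) (u u' : Multivector k V) :
    Multivector.push L (u - u') = Multivector.push L u - Multivector.push L u' :=
  rfl

theorem Multivector.push_neg (L : V →L[ℝ] W) (u : Multivector k V) :
    Multivector.push L (-u) = -Multivector.push L u :=
  rfl

variable [IsTopologicalAddGroup V] [ContinuousSMul ℝ V] [T2Space V] [FiniteDimensional ℝ V]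

theorem eq_of_dual_eq {v v' : V} (h : ∀ α : V →L[ℝ] ℝ, α v = α v') : v = v' := by
  apply (Module.evalEquiv ℝ V).injective
  ext α
  exact h (LinearMap.toContinuousLinearMap α)

theorem Multivector.sharp_eq_iff (u : Multivector 2 V) (α : V →L[ℝ] ℝ) (v : V) :
    u.sharp α = v ↔ ∀ β : V →L[ℝ] ℝ, u ![α, β] = β v := by
  constructor
  · rintro rfl β
    rw [Multivector.apply_sharp]
  · exact fun h => eq_of_dual_eq fun β => by rw [Multivector.apply_sharp, h]

theorem Multivector.sharp_injective :
    Function.Injective (Multivector.sharp : Multivector 2 V → _) := fun u u' h =>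
  pair_ext fun α β => by rw [← Multivector.apply_sharp, h, Multivector.apply_sharp]

theorem Multivector.sharp_sub (u u' : Multivector 2 V) (α : V →L[ℝ] ℝ) :
    (u - u').sharp α = u.sharp α - u'.sharp α := by
  rw [Multivector.sharp_eq_iff]
  intro β
  rw [map_sub, Multivector.apply_sharp, Multivector.apply_sharp]
  rfl

theorem Multivector.sharp_neg (u : Multivector 2 V) (α : V →L[ℝ] ℝ) :
    (-u).sharp α = -u.sharp α := by
  rw [Multivector.sharp_eq_iff]
  intro β
  rw [map_neg, Multivector.apply_sharp]
  rfl

theorem Multivector.sharp_add (u u' : Multivector 2 V) (α : V →L[ℝ] ℝ) :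
    (u + u').sharp α = u.sharp α + u'.sharp α := by
  rw [Multivector.sharp_eq_iff]
  intro β
  rw [map_add, Multivector.apply_sharp, Multivector.apply_sharp]
  rfl

variable [IsTopologicalAddGroup W] [ContinuousSMul ℝ W] [T2Space W] [FiniteDimensional ℝ W]

theorem Multivector.sharp_push (L : V →L[ℝ] W) (u : Multivector 2 V) (α : W →L[ℝ] ℝ) :
    (Multivector.push L u).sharp α = L (u.sharp (α.comp L)) := by
  rw [Multivector.sharp_eq_iff]
  intro β
  rw [Multivector.push_pair, ← Multivector.apply_sharp]
  rfl

theorem isInvertible_flat {w : V [⋀^Fin 2]→L[ℝ] ℝ}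
    (hw : ∀ v, (∀ v', w ![v, v'] = 0) → v = 0) : (flat w).IsInvertible := by
  have hinj : Function.Injective (flat w) := by
    rw [injective_iff_map_eq_zero]
    intro v hv
    exact hw v fun v' => by rw [← flat_apply, hv]; rfl
  have hdim : Module.finrank ℝ V = Module.finrank ℝ (V →L[ℝ] ℝ) := by
    rw [← (LinearMap.toContinuousLinearMap (𝕜 := ℝ) (E := V) (F' := ℝ)).finrank_eq]
    exact (Subspace.dual_finrank_eq (K := ℝ) (V := V)).symm
  have : FiniteDimensional ℝ (V →L[ℝ] ℝ) :=
    (LinearMap.toContinuousLinearMap (𝕜 := ℝ) (E := V) (F' := ℝ)).finiteDimensional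
  exact ⟨(LinearEquiv.ofInjectiveOfFinrankEq (flat w : V →ₗ[ℝ] V →L[ℝ] ℝ) hinj
    hdim).toContinuousLinearEquiv, rfl⟩

theorem sharp_inducedBivector_eq_inverse {w : V [⋀^Fin 2]→L[ℝ] ℝ} (hw : (flat w).IsInvertible)
    (α : V →L[ℝ] ℝ) : (inducedBivector w).sharp α = (flat w).inverse α := by
  obtain ⟨v, rfl⟩ := hw.bijective.2 α
  rw [sharp_inducedBivector w hw]
  exact (hw.inverse_apply_eq.2 rfl).symm

theorem flat_sharp_inducedBivector {w : V [⋀^Fin 2]→L[ℝ] ℝ} (hw : (flat w).IsInvertible)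
    (α : V →L[ℝ] ℝ) : flat w ((inducedBivector w).sharp α) = α := by
  rw [sharp_inducedBivector_eq_inverse hw]
  exact (hw.inverse_apply_eq.1 rfl).symm

/-- The bivector induced by `w` is the only bivector whose `♯` is a left inverse of `w♭`. -/
theorem eq_inducedBivector {w : V [⋀^Fin 2]→L[ℝ] ℝ} (hw : (flat w).IsInvertible)
    {u : Multivector 2 V} (h : ∀ v, u.sharp (flat w v) = v) : u = inducedBivector w := by
  apply Multivector.sharp_injective
  ext α
  obtain ⟨v, rfl⟩ := hw.bijective.2 α
  rw [h, sharp_inducedBivector w hw]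

theorem nondegenerate_inducedBivector {w : V [⋀^Fin 2]→L[ℝ] ℝ} (hw : (flat w).IsInvertible) :
    (inducedBivector w).Nondegenerate := by
  refine ⟨fun α β h => ?_, fun v => ⟨flat w v, sharp_inducedBivector w hw v⟩⟩
  rw [← flat_sharp_inducedBivector hw α, h, flat_sharp_inducedBivector hw]

/-- A nondegenerate two-form is determined by its induced bivector. -/
theorem inducedBivector_injOn {w w' : V [⋀^Fin 2]→L[ℝ] ℝ} (hw : (flat w).IsInvertible)
    (hw' : (flat w').IsInvertible) (h : inducedBivector w = inducedBivector w') : w = w' := by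
  refine pair_ext fun a b => ?_
  rw [← flat_apply, ← flat_apply]
  congr 1
  apply (nondegenerate_inducedBivector hw).1
  rw [sharp_inducedBivector w hw, h, sharp_inducedBivector w' hw']

theorem flat_comp (w : V [⋀^Fin 2]→L[ℝ] ℝ) (B : W →L[ℝ] V) (x : W) :
    flat (w.compContinuousLinearMap B) x = (flat w (B x)).comp B := by
  ext x'
  rw [flat_apply, comp_pair]
  rfl

theorem isInvertible_flat_comp {w : V [⋀^Fin 2]→L[ℝ] ℝ} (hw : (flat w).IsInvertible)
    {A : V →L[ℝ] W} {B : W →L[ℝ] V} (hAB : ∀ x, A (B x) = x) (hBA : ∀ v, B (A v) = v) :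
    (flat (w.compContinuousLinearMap B)).IsInvertible := by
  refine isInvertible_flat fun x hx => ?_
  have h0 : B x = 0 := by
    apply hw.bijective.1
    ext v
    have := hx (A v)
    rw [comp_pair, hBA] at this
    rw [flat_apply, this, map_zero]
    rfl
  rw [← hAB x, h0, map_zero]

/-- Pushing forward the bivector of `w` by an isomorphism `A` corresponds to pulling back `w` by
the inverse `B` of `A`. -/
theorem push_inducedBivector {w : V [⋀^Fin 2]→L[ℝ] ℝ} (hw : (flat w).IsInvertible)
    {A : V →L[ℝ] W} {B : W →L[ℝ] V} (hAB : ∀ x, A (B x) = x) (hBA : ∀ v, B (A v) = v) :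
    Multivector.push A (inducedBivector w) = inducedBivector (w.compContinuousLinearMap B) := by
  refine eq_inducedBivector (isInvertible_flat_comp hw hAB hBA) fun x => ?_
  rw [Multivector.sharp_push, flat_comp]
  have : ((flat w (B x)).comp B).comp A = flat w (B x) := by
    ext v
    simp [hBA]
  rw [this, sharp_inducedBivector w hw, hAB]

/-- The two-form `w` inverse to a nondegenerate bivector `u`, with `w♭ = (u♯)⁻¹`; it is
`w (v, v') = -u ((u♯)⁻¹ v, (u♯)⁻¹ v')`. -/
noncomputable def inverseForm (u : Multivector 2 V) (hu : u.Nondegenerate) :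
    V [⋀^Fin 2]→L[ℝ] ℝ :=
  -(u.compContinuousLinearMap
    (LinearMap.toContinuousLinearMap ((LinearEquiv.ofBijective u.sharp hu).symm : V →ₗ[ℝ] _)))

theorem flat_inverseForm_sharp (u : Multivector 2 V) (hu : u.Nondegenerate) (α : V →L[ℝ] ℝ) :
    flat (inverseForm u hu) (u.sharp α) = α := by
  have hs : ∀ β, (LinearEquiv.ofBijective u.sharp hu).symm (u.sharp β) = β := fun β =>
    (LinearEquiv.ofBijective u.sharp hu).symm_apply_apply β
  ext v
  obtain ⟨β, rfl⟩ := hu.2 v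
  rw [flat_apply, Multivector.apply_sharp, map_pair_swap u β α]
  change -(u.compContinuousLinearMap _ ![_, _]) = _
  rw [comp_pair]
  change -(u ![(LinearEquiv.ofBijective u.sharp hu).symm (u.sharp α),
    (LinearEquiv.ofBijective u.sharp hu).symm (u.sharp β)]) = _
  rw [hs, hs]

theorem isInvertible_flat_inverseForm (u : Multivector 2 V) (hu : u.Nondegenerate) :
    (flat (inverseForm u hu)).IsInvertible := by
  refine isInvertible_flat fun v hv => ?_
  obtain ⟨α, rfl⟩ := hu.2 v
  have : flat (inverseForm u hu) (u.sharp α) = 0 := by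
    ext v'
    exact hv v'
  rw [← flat_inverseForm_sharp u hu α, this, map_zero]

theorem inducedBivector_inverseForm (u : Multivector 2 V) (hu : u.Nondegenerate) :
    inducedBivector (inverseForm u hu) = u := by
  refine (eq_inducedBivector (isInvertible_flat_inverseForm u hu) fun v => ?_).symm
  obtain ⟨α, rfl⟩ := hu.2 v
  rw [flat_inverseForm_sharp]

/-- For linear maps `a`, `b` in opposite directions, `1 - a b` is injective if `1 - b a` is. -/
theorem injective_id_sub_comp {X Y : Type*} [AddCommGroup X] [Module ℝ X] [AddCommGroup Y]
    [Module ℝ Y] (a : X →ₗ[ℝ] Y) (b : Y →ₗ[ℝ] X)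
    (h : Function.Injective fun x => x - b (a x)) : Function.Injective fun y => y - a (b y) := by
  intro y y' hy
  have hb : b y = b y' := h (by
    have := congrArg b hy
    simpa using this)
  have : y - a (b y) = y' - a (b y') := hy
  rwa [hb, sub_left_inj] at this

end LinearAlgebraLemmas

/-! ### The Schouten bracket on a vector space -/

section LocalSchouten

variable {E E' : Type*} [NormedAddCommGroup E] [NormedSpace ℝ E] [FiniteDimensional ℝ E]
  [NormedAddCommGroup E'] [NormedSpace ℝ E'] [FiniteDimensional ℝ E']

instance instFiniteDimensionalContinuousAlternatingMap (k : ℕ) :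
    FiniteDimensional ℝ (E [⋀^Fin k]→L[ℝ] ℝ) :=
  FiniteDimensional.of_injective
    (V₂ := MultilinearMap ℝ (fun _ : Fin k => E) ℝ)
    { toFun := fun w => w.toContinuousMultilinearMap.toMultilinearMap
      map_add' := fun _ _ => rfl
      map_smul' := fun _ _ => rfl }
    fun w w' h => by
      ext v
      exact congrArg (fun m : MultilinearMap ℝ (fun _ : Fin k => E) ℝ => m v) h

omit [FiniteDimensional ℝ E] [FiniteDimensional ℝ E'] in
/-- The chain rule for a linear map, in a form that can be applied to spaces of alternating maps
by giving `E` and `E'` explicitly. -/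
theorem _root_.HasFDerivAt.clm_comp_left {X : Type*} [NormedAddCommGroup X] [NormedSpace ℝ X]
    (L : E →L[ℝ] E') {f : X → E} {f' : X →L[ℝ] E} {x : X} (hf : HasFDerivAt f f' x) :
    HasFDerivAt (fun x => L (f x)) (L.comp f') x :=
  L.hasFDerivAt.comp x hf

omit [FiniteDimensional ℝ E] [FiniteDimensional ℝ E'] in
theorem _root_.HasFDerivAt.clm_comp_right {X : Type*} [NormedAddCommGroup X] [NormedSpace ℝ X]
    (L : X →L[ℝ] E) {f : E → E'} {f' : E →L[ℝ] E'} {x : X} (hf : HasFDerivAt f f' (L x)) :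
    HasFDerivAt (fun x => f (L x)) (f'.comp L) x :=
  hf.comp x L.hasFDerivAt

variable (E) in
/-- The linear map `w ↦ w♭` on two-forms on `E`. -/
noncomputable def flatCLM : E [⋀^Fin 2]→L[ℝ] ℝ →L[ℝ] E →L[ℝ] E →L[ℝ] ℝ :=
  LinearMap.toContinuousLinearMap
    { toFun := fun w => flat w
      map_add' := fun _ _ => rfl
      map_smul' := fun _ _ => rfl }

theorem _root_.HasFDerivAt.flatCLM {X : Type*} [NormedAddCommGroup X] [NormedSpace ℝ X]
    {w : X → E [⋀^Fin 2]→L[ℝ] ℝ} {x : X} {w' : X →L[ℝ] E [⋀^Fin 2]→L[ℝ] ℝ}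
    (hw : HasFDerivAt w w' x) :
    HasFDerivAt (fun x => TwistDeformation.flatCLM E (w x))
      ((TwistDeformation.flatCLM E).comp w') x := by
  exact HasFDerivAt.clm_comp_left (E := E [⋀^Fin 2]→L[ℝ] ℝ) (E' := E →L[ℝ] E →L[ℝ] ℝ) _ hw

theorem flatCLM_apply (w : E [⋀^Fin 2]→L[ℝ] ℝ) (a b : E) : flatCLM E w a b = w ![a, b] :=
  rfl

variable (E) in
/-- The linear map `u ↦ u♯` on bivectors of `E`. -/
noncomputable def sharpCLM : Multivector 2 E →L[ℝ] (E →L[ℝ] ℝ) →L[ℝ] E :=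
  LinearMap.toContinuousLinearMap (𝕜 := ℝ) (E := Multivector 2 E) (F' := (E →L[ℝ] ℝ) →L[ℝ] E)
    { toFun := fun u => LinearMap.toContinuousLinearMap (𝕜 := ℝ) (Multivector.sharp u)
      map_add' := fun u u' => by
        ext α
        exact Multivector.sharp_add u u' α
      map_smul' := fun c u => by
        ext α
        refine (Multivector.sharp_eq_iff _ _ _).2 fun β => ?_
        change c • u ![α, β] = β (c • u.sharp α)
        rw [map_smul, Multivector.apply_sharp] }

theorem _root_.HasFDerivAt.sharpCLM {X : Type*} [NormedAddCommGroup X] [NormedSpace ℝ X]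
    {u : X → Multivector 2 E} {x : X} {u' : X →L[ℝ] Multivector 2 E}
    (hu : HasFDerivAt u u' x) :
    HasFDerivAt (fun x => TwistDeformation.sharpCLM E (u x))
      ((TwistDeformation.sharpCLM E).comp u') x := by
  exact HasFDerivAt.clm_comp_left (E := Multivector 2 E) (E' := (E →L[ℝ] ℝ) →L[ℝ] E) _ hu

/-- The linear map `Λᵏ L`. -/
noncomputable def pushCLM (k : ℕ) (L : E →L[ℝ] E') : Multivector k E →L[ℝ] Multivector k E' :=
  LinearMap.toContinuousLinearMap
    { toFun := Multivector.push L
      map_add' := fun _ _ => rfl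
      map_smul' := fun _ _ => rfl }

omit [FiniteDimensional ℝ E'] in
theorem _root_.HasFDerivAt.pushCLM {X : Type*} [NormedAddCommGroup X] [NormedSpace ℝ X] {k : ℕ}
    (L : E →L[ℝ] E') {u : X → Multivector k E} {x : X} {u' : X →L[ℝ] Multivector k E}
    (hu : HasFDerivAt u u' x) :
    HasFDerivAt (fun x => TwistDeformation.pushCLM k L (u x))
      ((TwistDeformation.pushCLM k L).comp u') x := by
  exact HasFDerivAt.clm_comp_left (E := Multivector k E) (E' := Multivector k E') _ hu

theorem alternatizeUncurryFin_triple {X : Type*} [NormedAddCommGroup X] [NormedSpace ℝ X]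
    (f : X →L[ℝ] X [⋀^Fin 2]→L[ℝ] ℝ) (a b c : X) :
    ContinuousAlternatingMap.alternatizeUncurryFin f ![a, b, c] =
      f a ![b, c] - f b ![a, c] + f c ![a, b] := by
  rw [ContinuousAlternatingMap.alternatizeUncurryFin_apply, Fin.sum_univ_three]
  have e0 : Fin.removeNth (0 : Fin 3) ![a, b, c] = ![b, c] := by ext i; fin_cases i <;> rfl
  have e1 : Fin.removeNth (1 : Fin 3) ![a, b, c] = ![a, c] := by ext i; fin_cases i <;> rfl
  have e2 : Fin.removeNth (2 : Fin 3) ![a, b, c] = ![a, b] := by ext i; fin_cases i <;> rfl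
  rw [e0, e1, e2]
  simp
  ring

theorem schoutenSelfE_apply (P : E → Multivector 2 E) (y : E) (α β γ : E →L[ℝ] ℝ) :
    schoutenSelfE P y ![α, β, γ] =
      2 * (fderiv ℝ P y ((P y).sharp α) ![β, γ] - fderiv ℝ P y ((P y).sharp β) ![α, γ]
        + fderiv ℝ P y ((P y).sharp γ) ![α, β]) := by
  change (2 : ℝ) * _ = _
  congr 1
  exact alternatizeUncurryFin_triple _ _ _ _

/-- Leibniz rule for the evaluation of a varying two-form on two varying vectors. -/
theorem hasFDerivAt_pair {X : Type*} [NormedAddCommGroup X] [NormedSpace ℝ X]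
    {w : X → E [⋀^Fin 2]→L[ℝ] ℝ} {a b : X → E} {x : X}
    {w' : X →L[ℝ] E [⋀^Fin 2]→L[ℝ] ℝ} {a' b' : X →L[ℝ] E}
    (hw : HasFDerivAt w w' x) (ha : HasFDerivAt a a' x) (hb : HasFDerivAt b b' x) :
    ∃ D : X →L[ℝ] ℝ, HasFDerivAt (fun x => w x ![a x, b x]) D x ∧
      ∀ v, D v = w' v ![a x, b x] + w x ![a' v, b x] + w x ![a x, b' v] := by
  have h1 : HasFDerivAt (fun x => flatCLM E (w x)) ((flatCLM E).comp w') x :=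
    hw.flatCLM
  refine ⟨_, (h1.clm_apply ha).clm_apply hb, fun v => ?_⟩
  simp [flatCLM_apply]
  ring

/-- First derivative of the relation `Q ∘ φ = φ_* P` between bivector fields. -/
theorem fderiv_related {φ : E → E'} {y₀ : E} (hφ : ContDiffAt ℝ 2 φ y₀)
    {P : E → Multivector 2 E} {Q : E' → Multivector 2 E'} (hP : DifferentiableAt ℝ P y₀)
    (hQ : DifferentiableAt ℝ Q (φ y₀))
    (h : ∀ᶠ y in 𝓝 y₀, Q (φ y) = Multivector.push (fderiv ℝ φ y) (P y))
    (v : E) (β γ : E' →L[ℝ] ℝ) :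
    fderiv ℝ Q (φ y₀) (fderiv ℝ φ y₀ v) ![β, γ] =
      fderiv ℝ P y₀ v ![β.comp (fderiv ℝ φ y₀), γ.comp (fderiv ℝ φ y₀)]
      + P y₀ ![β.comp (fderiv ℝ (fderiv ℝ φ) y₀ v), γ.comp (fderiv ℝ φ y₀)]
      + P y₀ ![β.comp (fderiv ℝ φ y₀), γ.comp (fderiv ℝ (fderiv ℝ φ) y₀ v)] := by
  have hφ1 : HasFDerivAt φ (fderiv ℝ φ y₀) y₀ :=
    (hφ.differentiableAt (by norm_num)).hasFDerivAt
  have hφ2 : HasFDerivAt (fderiv ℝ φ) (fderiv ℝ (fderiv ℝ φ) y₀) y₀ :=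
    ((hφ.fderiv_right (m := 1) (by norm_num)).differentiableAt (by norm_num)).hasFDerivAt
  have hβ : ∀ β : E' →L[ℝ] ℝ, HasFDerivAt (fun y => β.comp (fderiv ℝ φ y))
      ((ContinuousLinearMap.compL ℝ E E' ℝ β).comp (fderiv ℝ (fderiv ℝ φ) y₀)) y₀ := fun β =>
    (ContinuousLinearMap.compL ℝ E E' ℝ β).hasFDerivAt.comp y₀ hφ2
  obtain ⟨D, hD, hDv⟩ := hasFDerivAt_pair hP.hasFDerivAt (hβ β) (hβ γ)
  obtain ⟨D', hD', hDv'⟩ := hasFDerivAt_pair (hQ.hasFDerivAt.comp y₀ hφ1)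
    (hasFDerivAt_const β y₀) (hasFDerivAt_const γ y₀)
  have hDD : D' = D := by
    refine hD'.unique (hD.congr_of_eventuallyEq ?_)
    filter_upwards [h] with y hy
    simp only [Function.comp_apply, hy, Multivector.push_pair]
  have e := hDv' v
  rw [hDD, hDv v] at e
  have z1 : (Q ∘ φ) y₀ ![(0 : E →L[ℝ] E' →L[ℝ] ℝ) v, γ] = 0 :=
    ContinuousAlternatingMap.map_coord_zero _ 0 rfl
  have z2 : (Q ∘ φ) y₀ ![β, (0 : E →L[ℝ] E' →L[ℝ] ℝ) v] = 0 :=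
    ContinuousAlternatingMap.map_coord_zero _ 1 rfl
  rw [z1, z2, add_zero, add_zero] at e
  exact e.symm

/-- Naturality of the Schouten bracket: if `φ` relates `P` to `Q`, it relates `[P, P]` to
`[Q, Q]`. The terms with second derivatives of `φ` cancel in the cyclic sum by their symmetry. -/
theorem schoutenSelfE_related {φ : E → E'} {y₀ : E} (hφ : ContDiffAt ℝ 2 φ y₀)
    {P : E → Multivector 2 E} {Q : E' → Multivector 2 E'} (hP : DifferentiableAt ℝ P y₀)
    (hQ : DifferentiableAt ℝ Q (φ y₀))
    (h : ∀ᶠ y in 𝓝 y₀, Q (φ y) = Multivector.push (fderiv ℝ φ y) (P y)) :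
    schoutenSelfE Q (φ y₀) = Multivector.push (fderiv ℝ φ y₀) (schoutenSelfE P y₀) := by
  refine triple_ext fun α β γ => ?_
  have hs : ∀ v v', fderiv ℝ (fderiv ℝ φ) y₀ v v' = fderiv ℝ (fderiv ℝ φ) y₀ v' v :=
    fun v v' => (hφ.isSymmSndFDerivAt (by simp)) v v'
  have hsharp : ∀ α : E' →L[ℝ] ℝ, (Q (φ y₀)).sharp α =
      fderiv ℝ φ y₀ ((P y₀).sharp (α.comp (fderiv ℝ φ y₀))) := fun α => by
    rw [h.self_of_nhds, Multivector.sharp_push]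
  rw [Multivector.push_triple, schoutenSelfE_apply, schoutenSelfE_apply, hsharp, hsharp, hsharp,
    fderiv_related hφ hP hQ h, fderiv_related hφ hP hQ h, fderiv_related hφ hP hQ h]
  have hr : ∀ (α β : E' →L[ℝ] ℝ) (v : E),
      P y₀ ![α.comp (fderiv ℝ φ y₀), β.comp (fderiv ℝ (fderiv ℝ φ) y₀ v)] =
        β (fderiv ℝ (fderiv ℝ φ) y₀ v ((P y₀).sharp (α.comp (fderiv ℝ φ y₀)))) := fun α β v => by
    rw [← Multivector.apply_sharp]
    rfl
  have hl : ∀ (α β : E' →L[ℝ] ℝ) (v : E),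
      P y₀ ![β.comp (fderiv ℝ (fderiv ℝ φ) y₀ v), α.comp (fderiv ℝ φ y₀)] =
        -β (fderiv ℝ (fderiv ℝ φ) y₀ v ((P y₀).sharp (α.comp (fderiv ℝ φ y₀)))) := fun α β v => by
    rw [map_pair_swap, hr]
  simp only [hr, hl]
  set vα := (P y₀).sharp (α.comp (fderiv ℝ φ y₀))
  set vβ := (P y₀).sharp (β.comp (fderiv ℝ φ y₀))
  set vγ := (P y₀).sharp (γ.comp (fderiv ℝ φ y₀))
  rw [hs vβ vα, hs vγ vα, hs vγ vβ]
  ring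

/-- The bivector field `P₁ + P₂` on a product of vector spaces. -/
noncomputable def prodBivectorE (P₁ : E → Multivector 2 E) (P₂ : E' → Multivector 2 E') :
    E × E' → Multivector 2 (E × E') := fun z =>
  Multivector.push (ContinuousLinearMap.inl ℝ E E') (P₁ z.1)
    + Multivector.push (ContinuousLinearMap.inr ℝ E E') (P₂ z.2)

theorem hasFDerivAt_prodBivectorE {P₁ : E → Multivector 2 E} {P₂ : E' → Multivector 2 E'}
    {z : E × E'} (h₁ : DifferentiableAt ℝ P₁ z.1) (h₂ : DifferentiableAt ℝ P₂ z.2) :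
    ∃ D : E × E' →L[ℝ] Multivector 2 (E × E'), HasFDerivAt (prodBivectorE P₁ P₂) D z ∧
      ∀ (v : E × E') (β γ : E × E' →L[ℝ] ℝ),
      D v ![β, γ] =
      fderiv ℝ P₁ z.1 v.1 ![β.comp (ContinuousLinearMap.inl ℝ E E'),
        γ.comp (ContinuousLinearMap.inl ℝ E E')]
      + fderiv ℝ P₂ z.2 v.2 ![β.comp (ContinuousLinearMap.inr ℝ E E'),
        γ.comp (ContinuousLinearMap.inr ℝ E E')] := by
  have a := HasFDerivAt.clm_comp_right (E' := Multivector 2 E) (x := z)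
    (ContinuousLinearMap.fst ℝ E E') h₁.hasFDerivAt
  have b := HasFDerivAt.clm_comp_right (E' := Multivector 2 E') (x := z)
    (ContinuousLinearMap.snd ℝ E E') h₂.hasFDerivAt
  have a' := a.pushCLM (ContinuousLinearMap.inl ℝ E E')
  have b' := b.pushCLM (ContinuousLinearMap.inr ℝ E E')
  have c := HasFDerivAt.add (𝕜 := ℝ) (E := E × E') (F := Multivector 2 (E × E')) a' b'
  refine ⟨_, c, fun v β γ => ?_⟩
  rw [← Multivector.push_pair, ← Multivector.push_pair]
  rfl

/-- The mixed terms of the Schouten bracket of a product bivector field vanish. -/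
theorem schoutenSelfE_prodBivectorE {P₁ : E → Multivector 2 E} {P₂ : E' → Multivector 2 E'}
    {z : E × E'} (h₁ : DifferentiableAt ℝ P₁ z.1) (h₂ : DifferentiableAt ℝ P₂ z.2) :
    schoutenSelfE (prodBivectorE P₁ P₂) z =
      Multivector.push (ContinuousLinearMap.inl ℝ E E') (schoutenSelfE P₁ z.1)
      + Multivector.push (ContinuousLinearMap.inr ℝ E E') (schoutenSelfE P₂ z.2) := by
  obtain ⟨D, hD, e⟩ := hasFDerivAt_prodBivectorE h₁ h₂
  refine triple_ext fun α β γ => ?_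
  rw [ContinuousAlternatingMap.add_apply, Multivector.push_triple, Multivector.push_triple,
    schoutenSelfE_apply, schoutenSelfE_apply, schoutenSelfE_apply, hD.fderiv]
  have e1 : ∀ α : E × E' →L[ℝ] ℝ, ((prodBivectorE P₁ P₂ z).sharp α).1 =
      (P₁ z.1).sharp (α.comp (ContinuousLinearMap.inl ℝ E E')) := fun α => by
    rw [prodBivectorE, Multivector.sharp_add, Multivector.sharp_push, Multivector.sharp_push]
    simp
  have e2 : ∀ α : E × E' →L[ℝ] ℝ, ((prodBivectorE P₁ P₂ z).sharp α).2 =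
      (P₂ z.2).sharp (α.comp (ContinuousLinearMap.inr ℝ E E')) := fun α => by
    rw [prodBivectorE, Multivector.sharp_add, Multivector.sharp_push, Multivector.sharp_push]
    simp
  simp only [e, e1, e2]
  ring

/-- For mutually inverse `W` and `P`, the exterior derivative of `W` corresponds to the Schouten
bracket of `P` under `P♯`, up to the factor `2`. -/
theorem schoutenSelfE_eq_extDeriv {W : E → E [⋀^Fin 2]→L[ℝ] ℝ} {P : E → Multivector 2 E} {y : E}
    (hW : DifferentiableAt ℝ W y) (hP : DifferentiableAt ℝ P y)
    (h : ∀ᶠ x in 𝓝 y, ∀ α, flat (W x) ((P x).sharp α) = α) (α β γ : E →L[ℝ] ℝ) :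
    schoutenSelfE P y ![α, β, γ] =
      2 * extDeriv W y ![(P y).sharp α, (P y).sharp β, (P y).sharp γ] := by
  have hs : ∀ α : E →L[ℝ] ℝ, HasFDerivAt (fun x => (P x).sharp α)
      (((sharpCLM E).comp (fderiv ℝ P y)).flip α) y := fun α => by
    have := hP.hasFDerivAt.sharpCLM.clm_apply (hasFDerivAt_const α y)
    convert! this using 1
    ext v
    simp
  -- the derivative of `W (P♯ α, P♯ β) = P (β, α)`
  have key : ∀ (v : E) (α β : E →L[ℝ] ℝ),
      fderiv ℝ W y v ![(P y).sharp α, (P y).sharp β] = fderiv ℝ P y v ![α, β] := by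
    intro v α β
    obtain ⟨D, hD, hDv⟩ := hasFDerivAt_pair hW.hasFDerivAt (hs α) (hs β)
    obtain ⟨D', hD', hDv'⟩ := hasFDerivAt_pair hP.hasFDerivAt
      (hasFDerivAt_const β y) (hasFDerivAt_const α y)
    have hDD : D = D' := by
      refine hD.unique (hD'.congr_of_eventuallyEq ?_)
      filter_upwards [h] with x hx
      rw [← flat_apply, hx, Multivector.apply_sharp]
    have e := hDv v
    rw [hDD, hDv' v] at e
    have z1 : P y ![(0 : E →L[ℝ] E →L[ℝ] ℝ) v, α] = 0 :=
      ContinuousAlternatingMap.map_coord_zero _ 0 rfl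
    have z2 : P y ![β, (0 : E →L[ℝ] E →L[ℝ] ℝ) v] = 0 :=
      ContinuousAlternatingMap.map_coord_zero _ 1 rfl
    have hf := h.self_of_nhds
    have f1 : ∀ α : E →L[ℝ] ℝ, ((sharpCLM E).comp (fderiv ℝ P y)).flip α v =
      (fderiv ℝ P y v).sharp α := fun α => rfl
    rw [z1, z2, f1, f1, map_pair_swap (W y) ((fderiv ℝ P y v).sharp α),
      ← flat_apply (W y), hf, ← flat_apply (W y), hf, Multivector.apply_sharp,
      Multivector.apply_sharp,
      map_pair_swap (fderiv ℝ P y v) β α] at e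
    linarith
  rw [schoutenSelfE_apply, extDeriv, alternatizeUncurryFin_triple, key, key, key]

/-- A family of two-forms is smooth if its values on all pairs of constant vectors are. -/
theorem contDiffOn_of_pair {X : Type*} [NormedAddCommGroup X] [NormedSpace ℝ X]
    {n : WithTop ℕ∞} {s : Set X} {w : X → E [⋀^Fin 2]→L[ℝ] ℝ}
    (h : ∀ a b, ContDiffOn ℝ n (fun x => w x ![a, b]) s) : ContDiffOn ℝ n w s := by
  have hinj : Function.Injective (flatCLM E) := fun w w' h =>
    pair_ext fun a b => by rw [← flatCLM_apply, h, flatCLM_apply]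
  obtain ⟨g, hg⟩ := LinearMap.exists_leftInverse_of_injective (K := ℝ)
    (V := E [⋀^Fin 2]→L[ℝ] ℝ) (V' := E →L[ℝ] E →L[ℝ] ℝ) (flatCLM E).toLinearMap
    ((Submodule.eq_bot_iff _).2 fun x hx => hinj (hx.trans (map_zero (flatCLM E)).symm))
  have h1 : ContDiffOn ℝ n (fun x => flatCLM E (w x)) s :=
    contDiffOn_clm_apply.2 fun a => contDiffOn_clm_apply.2 fun b => h a b
  have h2 := (LinearMap.toContinuousLinearMap g).contDiff.comp_contDiffOn h1
  refine h2.congr fun x _ => ?_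
  exact (LinearMap.congr_fun hg (w x)).symm

end LocalSchouten

/-! ### Naturality of the Schouten bracket on manifolds -/

section Charts

variable {E : Type*} [NormedAddCommGroup E] [NormedSpace ℝ E]
  {M : Type*} [TopologicalSpace M] [ChartedSpace E M]
  {E' : Type*} [NormedAddCommGroup E'] [NormedSpace ℝ E']
  {M' : Type*} [TopologicalSpace M'] [ChartedSpace E' M']
  {E'' : Type*} [NormedAddCommGroup E''] [NormedSpace ℝ E'']
  {M'' : Type*} [TopologicalSpace M''] [ChartedSpace E'' M'']

theorem push_mfderiv_comp {k : ℕ} {f : M → M'} {g : M' → M''} {x : M} {y : M'} (hy : f x = y)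
    (hf : MDifferentiableAt 𝓘(ℝ, E) 𝓘(ℝ, E') f x)
    (hg : MDifferentiableAt 𝓘(ℝ, E') 𝓘(ℝ, E'') g y)
    (u : Multivector k (TangentSpace 𝓘(ℝ, E) x)) :
    Multivector.push (mfderiv 𝓘(ℝ, E') 𝓘(ℝ, E'') g y)
        (Multivector.push (mfderiv 𝓘(ℝ, E) 𝓘(ℝ, E') f x) u) =
      Multivector.push (mfderiv 𝓘(ℝ, E) 𝓘(ℝ, E'') (g ∘ f) x) u := by
  subst hy
  rw [mfderiv_comp x hg hf]
  rfl

variable [IsManifold 𝓘(ℝ, E) ∞ M]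

theorem contMDiffAt_extChartAt_of_mem {x₀ p : M} (hp : p ∈ (extChartAt 𝓘(ℝ, E) x₀).source) :
    ContMDiffAt 𝓘(ℝ, E) 𝓘(ℝ, E) ∞ (extChartAt 𝓘(ℝ, E) x₀) p :=
  contMDiffAt_extChartAt' (by rwa [extChartAt_source] at hp)

omit [IsManifold 𝓘(ℝ, E) ∞ M] in
theorem extChartAt_target_mem_nhds_of_mem {x₀ : M} {y : E}
    (hy : y ∈ (extChartAt 𝓘(ℝ, E) x₀).target) : (extChartAt 𝓘(ℝ, E) x₀).target ∈ 𝓝 y :=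
  (isOpen_extChartAt_target x₀).mem_nhds hy

theorem contMDiffAt_extChartAt_symm_of_mem {x₀ : M} {y : E}
    (hy : y ∈ (extChartAt 𝓘(ℝ, E) x₀).target) :
    ContMDiffAt 𝓘(ℝ, E) 𝓘(ℝ, E) ∞ (extChartAt 𝓘(ℝ, E) x₀).symm y :=
  (contMDiffOn_extChartAt_symm x₀).contMDiffAt (extChartAt_target_mem_nhds_of_mem hy)

theorem mdifferentiableAt_extChartAt_of_mem {x₀ p : M}
    (hp : p ∈ (extChartAt 𝓘(ℝ, E) x₀).source) :
    MDifferentiableAt 𝓘(ℝ, E) 𝓘(ℝ, E) (extChartAt 𝓘(ℝ, E) x₀) p :=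
  (contMDiffAt_extChartAt_of_mem hp).mdifferentiableAt (by simp)

theorem mdifferentiableAt_extChartAt_symm_of_mem {x₀ : M} {y : E}
    (hy : y ∈ (extChartAt 𝓘(ℝ, E) x₀).target) :
    MDifferentiableAt 𝓘(ℝ, E) 𝓘(ℝ, E) (extChartAt 𝓘(ℝ, E) x₀).symm y :=
  (contMDiffAt_extChartAt_symm_of_mem hy).mdifferentiableAt (by simp)

theorem mfderiv_extChartAt_symm_apply {x₀ : M} {y : E}
    (hy : y ∈ (extChartAt 𝓘(ℝ, E) x₀).target)
    (v : TangentSpace 𝓘(ℝ, E) ((extChartAt 𝓘(ℝ, E) x₀).symm y)) :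
    mfderiv 𝓘(ℝ, E) 𝓘(ℝ, E) (extChartAt 𝓘(ℝ, E) x₀).symm y
      (mfderiv 𝓘(ℝ, E) 𝓘(ℝ, E) (extChartAt 𝓘(ℝ, E) x₀)
        ((extChartAt 𝓘(ℝ, E) x₀).symm y) v) = v := by
  have : IsManifold 𝓘(ℝ, E) 1 M := IsManifold.of_le (n := ∞) (by simp)
  have h := mfderivWithin_extChartAt_symm_comp_mfderiv_extChartAt (I := 𝓘(ℝ, E)) hy
  rw [modelWithCornersSelf_coe, Set.range_id, mfderivWithin_univ] at h
  exact DFunLike.congr_fun h v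

theorem mfderiv_extChartAt_apply {x₀ : M} {y : E}
    (hy : y ∈ (extChartAt 𝓘(ℝ, E) x₀).target) (v : E) :
    mfderiv 𝓘(ℝ, E) 𝓘(ℝ, E) (extChartAt 𝓘(ℝ, E) x₀) ((extChartAt 𝓘(ℝ, E) x₀).symm y)
      (mfderiv 𝓘(ℝ, E) 𝓘(ℝ, E) (extChartAt 𝓘(ℝ, E) x₀).symm y v) = v := by
  have : IsManifold 𝓘(ℝ, E) 1 M := IsManifold.of_le (n := ∞) (by simp)
  have h := mfderiv_extChartAt_comp_mfderivWithin_extChartAt_symm (I := 𝓘(ℝ, E)) hy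
  rw [modelWithCornersSelf_coe, Set.range_id, mfderivWithin_univ] at h
  exact DFunLike.congr_fun h v

omit [IsManifold 𝓘(ℝ, E) ∞ M] in
theorem MultivectorField.inChart_apply {k : ℕ} (u : MultivectorField E M k) {x₀ p : M}
    (hp : p ∈ (extChartAt 𝓘(ℝ, E) x₀).source) :
    u.inChart x₀ (extChartAt 𝓘(ℝ, E) x₀ p) =
      Multivector.push (mfderiv 𝓘(ℝ, E) 𝓘(ℝ, E) (extChartAt 𝓘(ℝ, E) x₀) p) (u p) := by
  -- `c.symm (c p) = p` is not definitional, so the equation is read in the model space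
  have h : ∀ q, q = p →
      Multivector.push (mfderiv 𝓘(ℝ, E) 𝓘(ℝ, E) (extChartAt 𝓘(ℝ, E) x₀) q) (u q) =
      (Multivector.push (mfderiv 𝓘(ℝ, E) 𝓘(ℝ, E) (extChartAt 𝓘(ℝ, E) x₀) p) (u p) :
        Multivector k E) := by
    rintro q rfl
    rfl
  exact h _ ((extChartAt 𝓘(ℝ, E) x₀).left_inv hp)

theorem MultivectorField.push_inChart {k : ℕ} (u : MultivectorField E M k) {x₀ : M} {y : E}
    (hy : y ∈ (extChartAt 𝓘(ℝ, E) x₀).target) :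
    Multivector.push (mfderiv 𝓘(ℝ, E) 𝓘(ℝ, E) (extChartAt 𝓘(ℝ, E) x₀).symm y)
      (u.inChart x₀ y) = u ((extChartAt 𝓘(ℝ, E) x₀).symm y) := by
  ext ξ
  change u _ _ = u _ _
  congr 1
  ext i v
  exact congrArg (ξ i) (mfderiv_extChartAt_symm_apply hy v)

omit [IsManifold 𝓘(ℝ, E) ∞ M] in
theorem MultivectorField.IsSmooth.contDiffAt_inChart {k : ℕ} {u : MultivectorField E M k}
    (hu : u.IsSmooth) {x₀ : M} {y : E} (hy : y ∈ (extChartAt 𝓘(ℝ, E) x₀).target) :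
    ContDiffAt ℝ ∞ (u.inChart x₀) y :=
  (hu x₀).contDiffAt ((isOpen_extChartAt_target x₀).mem_nhds hy)

omit [IsManifold 𝓘(ℝ, E) ∞ M] in
theorem MultivectorField.IsSmooth.differentiableAt_inChart {k : ℕ} {u : MultivectorField E M k}
    (hu : u.IsSmooth) {x₀ : M} {y : E} (hy : y ∈ (extChartAt 𝓘(ℝ, E) x₀).target) :
    DifferentiableAt ℝ (u.inChart x₀) y :=
  (hu.contDiffAt_inChart hy).differentiableAt (by simp)

variable [FiniteDimensional ℝ E] [FiniteDimensional ℝ E'] [FiniteDimensional ℝ E'']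
  [IsManifold 𝓘(ℝ, E') ∞ M'] [IsManifold 𝓘(ℝ, E'') ∞ M'']

/-- Naturality of the Schouten bracket under a smooth map `ψ` from a vector space to a
manifold. -/
theorem schoutenSelf_param {ψ : E' → M} {y₀ : E'}
    (hψ : ContMDiffAt 𝓘(ℝ, E') 𝓘(ℝ, E) ∞ ψ y₀)
    {P : MultivectorField E M 2} (hP : P.IsSmooth)
    {P' : E' → Multivector 2 E'} (hP' : DifferentiableAt ℝ P' y₀)
    (h : ∀ᶠ y in 𝓝 y₀, P (ψ y) =
      Multivector.push (V := E') (mfderiv 𝓘(ℝ, E') 𝓘(ℝ, E) ψ y) (P' y)) :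
    schoutenSelf P (ψ y₀) =
      Multivector.push (V := E') (mfderiv 𝓘(ℝ, E') 𝓘(ℝ, E) ψ y₀) (schoutenSelfE P' y₀) := by
  set c := extChartAt 𝓘(ℝ, E) (ψ y₀) with hc
  have hsrc : ψ y₀ ∈ c.source := mem_extChartAt_source (ψ y₀)
  have htgt : c (ψ y₀) ∈ c.target := c.map_source hsrc
  have hψs : ∀ᶠ y in 𝓝 y₀, ψ y ∈ c.source :=
    hψ.continuousAt.preimage_mem_nhds ((isOpen_extChartAt_source (ψ y₀)).mem_nhds hsrc)
  have hψd : ∀ᶠ y in 𝓝 y₀, MDifferentiableAt 𝓘(ℝ, E') 𝓘(ℝ, E) ψ y := by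
    have : IsManifold 𝓘(ℝ, E) 1 M := IsManifold.of_le (n := ∞) (by simp)
    have h1 : ContMDiffAt 𝓘(ℝ, E') 𝓘(ℝ, E) 1 ψ y₀ := hψ.of_le (by simp)
    filter_upwards [(contMDiffAt_iff_contMDiffAt_nhds (by simp)).1 h1] with y hy
    exact hy.mdifferentiableAt (by simp)
  have hφ : ContDiffAt ℝ ∞ (c ∘ ψ) y₀ :=
    ((contMDiffAt_extChartAt_of_mem hsrc).comp y₀ hψ).contDiffAt
  have hrel : ∀ᶠ y in 𝓝 y₀, P.inChart (ψ y₀) ((c ∘ ψ) y) =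
      Multivector.push (fderiv ℝ (c ∘ ψ) y) (P' y) := by
    filter_upwards [h, hψs, hψd] with y hy hys hyd
    refine (P.inChart_apply hys).trans ?_
    rw [hy, ← mfderiv_eq_fderiv]
    exact push_mfderiv_comp (M := E') rfl hyd (mdifferentiableAt_extChartAt_of_mem hys) _
  have hS := schoutenSelfE_related (hφ.of_le (WithTop.coe_le_coe.2 le_top)) hP'
    (hP.differentiableAt_inChart htgt) hrel
  have hψ' : c.symm ∘ (c ∘ ψ) =ᶠ[𝓝 y₀] ψ := by
    filter_upwards [hψs] with y hy
    exact c.left_inv hy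
  change Multivector.push (V := E) (mfderiv 𝓘(ℝ, E) 𝓘(ℝ, E) c.symm (c (ψ y₀)))
    (schoutenSelfE (P.inChart (ψ y₀)) ((c ∘ ψ) y₀)) = _
  rw [hS, ← mfderiv_eq_fderiv]
  refine (push_mfderiv_comp (M := E') (M' := E) (y := c (ψ y₀)) rfl
    (hφ.differentiableAt (by simp)).mdifferentiableAt
    (mdifferentiableAt_extChartAt_symm_of_mem htgt) (schoutenSelfE (E := E') P' y₀)).trans ?_
  rw [hψ'.mfderiv_eq]
  rfl

/-- The Schouten bracket may be computed in any chart. -/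
theorem schoutenSelf_inChart {P : MultivectorField E M 2} (hP : P.IsSmooth) {x₀ : M} {y : E}
    (hy : y ∈ (extChartAt 𝓘(ℝ, E) x₀).target) :
    schoutenSelf P ((extChartAt 𝓘(ℝ, E) x₀).symm y) =
      Multivector.push (V := E) (mfderiv 𝓘(ℝ, E) 𝓘(ℝ, E) (extChartAt 𝓘(ℝ, E) x₀).symm y)
        (schoutenSelfE (P.inChart x₀) y) := by
  refine schoutenSelf_param (contMDiffAt_extChartAt_symm_of_mem hy) hP
    (hP.differentiableAt_inChart hy) ?_
  filter_upwards [extChartAt_target_mem_nhds_of_mem hy] with z hz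
  exact (P.push_inChart hz).symm

theorem schoutenSelfE_inChart_eq_zero {P : MultivectorField E M 2} (hP : IsPoisson P) {x₀ : M}
    {y : E} (hy : y ∈ (extChartAt 𝓘(ℝ, E) x₀).target) :
    schoutenSelfE (P.inChart x₀) y = 0 := by
  have h := schoutenSelf_inChart hP.smooth hy
  rw [hP.schouten_eq_zero] at h
  ext ξ
  have h2 := DFunLike.congr_fun h fun i => (ξ i).comp
    (mfderiv 𝓘(ℝ, E) 𝓘(ℝ, E) (extChartAt 𝓘(ℝ, E) x₀) ((extChartAt 𝓘(ℝ, E) x₀).symm y))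
  refine Eq.trans ?_ h2.symm
  change schoutenSelfE (P.inChart x₀) y _ = schoutenSelfE (P.inChart x₀) y _
  congr 1
  ext i v
  exact congrArg (ξ i) (mfderiv_extChartAt_apply hy v).symm

/-- Naturality of the Schouten bracket under a smooth map between manifolds. -/
theorem schoutenSelf_related {f : M → M'} (hf : ContMDiff 𝓘(ℝ, E) 𝓘(ℝ, E') ∞ f)
    {P : MultivectorField E M 2} {Q : MultivectorField E' M' 2} (hP : P.IsSmooth)
    (hQ : Q.IsSmooth)
    (h : ∀ p, Q (f p) = Multivector.push (mfderiv 𝓘(ℝ, E) 𝓘(ℝ, E') f p) (P p)) (p : M) :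
    schoutenSelf Q (f p) =
      Multivector.push (mfderiv 𝓘(ℝ, E) 𝓘(ℝ, E') f p) (schoutenSelf P p) := by
  set c := extChartAt 𝓘(ℝ, E) p with hc
  have htgt : c p ∈ c.target := mem_extChartAt_target p
  have hcp : c.symm (c p) = p := c.left_inv (mem_extChartAt_source p)
  have key := schoutenSelf_param (ψ := f ∘ c.symm) (y₀ := c p) (P := Q) (P' := P.inChart p)
    (hf.contMDiffAt.comp (c p) (contMDiffAt_extChartAt_symm_of_mem htgt)) hQ
    (hP.differentiableAt_inChart htgt) (by
      filter_upwards [extChartAt_target_mem_nhds_of_mem htgt] with z hz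
      refine (h (c.symm z)).trans ?_
      rw [← P.push_inChart hz]
      exact push_mfderiv_comp (M := E) rfl (mdifferentiableAt_extChartAt_symm_of_mem hz)
        (hf.mdifferentiableAt (by simp)) _)
  have e := push_mfderiv_comp (M := E) (g := f) (y := p) hcp
    (mdifferentiableAt_extChartAt_symm_of_mem htgt)
    (hf.mdifferentiableAt (by simp)) (schoutenSelfE (E := E) (P.inChart p) (c p))
  refine Eq.trans ?_ e.symm
  have : ∀ q, q = p → schoutenSelf Q (f q) = (schoutenSelf Q (f p) : Multivector 3 E') := by
    rintro q rfl; rfl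
  exact (this _ hcp).symm.trans key

/-- Naturality of the Schouten bracket under a smooth map `a : M × M' → M''`, relating the
product of `P₁` and `P₂` to `Q`. -/
theorem schoutenSelf_related_prod {a : M × M' → M''}
    (ha : ContMDiff (𝓘(ℝ, E).prod 𝓘(ℝ, E')) 𝓘(ℝ, E'') ∞ a)
    {P₁ : MultivectorField E M 2} {P₂ : MultivectorField E' M' 2} {Q : MultivectorField E'' M'' 2}
    (hP₁ : P₁.IsSmooth) (hP₂ : P₂.IsSmooth) (hQ : Q.IsSmooth)
    (h : ∀ p q, Q (a (p, q)) =
      Multivector.push (mfderiv 𝓘(ℝ, E) 𝓘(ℝ, E'') (fun p' => a (p', q)) p) (P₁ p)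
      + Multivector.push (mfderiv 𝓘(ℝ, E') 𝓘(ℝ, E'') (fun q' => a (p, q')) q) (P₂ q))
    (p : M) (q : M') :
    schoutenSelf Q (a (p, q)) =
      Multivector.push (mfderiv 𝓘(ℝ, E) 𝓘(ℝ, E'') (fun p' => a (p', q)) p) (schoutenSelf P₁ p)
      + Multivector.push (mfderiv 𝓘(ℝ, E') 𝓘(ℝ, E'') (fun q' => a (p, q')) q)
        (schoutenSelf P₂ q) := by
  set c := extChartAt 𝓘(ℝ, E) p with hc
  set c' := extChartAt 𝓘(ℝ, E') q with hc'
  have ht : c p ∈ c.target := mem_extChartAt_target p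
  have ht' : c' q ∈ c'.target := mem_extChartAt_target q
  have hcp : c.symm (c p) = p := c.left_inv (mem_extChartAt_source p)
  have hcq : c'.symm (c' q) = q := c'.left_inv (mem_extChartAt_source q)
  have ha₁ : ∀ q, ContMDiff 𝓘(ℝ, E) 𝓘(ℝ, E'') ∞ fun p => a (p, q) := fun q =>
    ha.comp (contMDiff_id.prodMk contMDiff_const)
  have ha₂ : ∀ p, ContMDiff 𝓘(ℝ, E') 𝓘(ℝ, E'') ∞ fun q => a (p, q) := fun p =>
    ha.comp (contMDiff_const.prodMk contMDiff_id)
  set ψ : E × E' → M'' := fun z => a (c.symm z.1, c'.symm z.2) with hψ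
  have hψs : ∀ z : E × E', z.1 ∈ c.target → z.2 ∈ c'.target →
      ContMDiffAt 𝓘(ℝ, E × E') 𝓘(ℝ, E'') ∞ ψ z := fun z hz hz' => by
    have h1 : ContMDiffAt 𝓘(ℝ, E × E') 𝓘(ℝ, E) ∞ (fun z : E × E' => c.symm z.1) z :=
      (contMDiffAt_extChartAt_symm_of_mem hz).comp z contDiff_fst.contMDiff.contMDiffAt
    have h2 : ContMDiffAt 𝓘(ℝ, E × E') 𝓘(ℝ, E') ∞ (fun z : E × E' => c'.symm z.2) z :=
      (contMDiffAt_extChartAt_symm_of_mem hz').comp z contDiff_snd.contMDiff.contMDiffAt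
    exact ha.contMDiffAt.comp z (h1.prodMk h2)
  -- the two partial derivatives of `ψ`
  have hp1 : ∀ {k : ℕ} (z : E × E') (_ : z.1 ∈ c.target) (_ : z.2 ∈ c'.target)
      (u : Multivector k E),
      Multivector.push (V := E × E') (mfderiv 𝓘(ℝ, E × E') 𝓘(ℝ, E'') ψ z)
        (Multivector.push (ContinuousLinearMap.inl ℝ E E') u) =
      Multivector.push (mfderiv 𝓘(ℝ, E) 𝓘(ℝ, E'') (fun p' => a (p', c'.symm z.2)) (c.symm z.1))
        (Multivector.push (V := E) (mfderiv 𝓘(ℝ, E) 𝓘(ℝ, E) c.symm z.1) u) := by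
    intro k z hz hz' u
    have hi : HasFDerivAt (fun x : E => (x, z.2)) (ContinuousLinearMap.inl ℝ E E') z.1 :=
      hasFDerivAt_prodMk_left z.1 z.2
    have e1 := push_mfderiv_comp (M := E) (M' := E × E') (g := ψ) (y := z) rfl
      hi.differentiableAt.mdifferentiableAt ((hψs z hz hz').mdifferentiableAt (by simp)) u
    have e2 := push_mfderiv_comp (M := E) (g := fun p' => a (p', c'.symm z.2)) rfl
      (mdifferentiableAt_extChartAt_symm_of_mem hz)
      ((ha₁ (c'.symm z.2)).mdifferentiableAt (by simp)) u
    rw [mfderiv_eq_fderiv, hi.fderiv] at e1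
    exact e1.trans e2.symm
  have hp2 : ∀ {k : ℕ} (z : E × E') (_ : z.1 ∈ c.target) (_ : z.2 ∈ c'.target)
      (u : Multivector k E'),
      Multivector.push (V := E × E') (mfderiv 𝓘(ℝ, E × E') 𝓘(ℝ, E'') ψ z)
        (Multivector.push (ContinuousLinearMap.inr ℝ E E') u) =
      Multivector.push (mfderiv 𝓘(ℝ, E') 𝓘(ℝ, E'') (fun q' => a (c.symm z.1, q')) (c'.symm z.2))
        (Multivector.push (V := E') (mfderiv 𝓘(ℝ, E') 𝓘(ℝ, E') c'.symm z.2) u) := by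
    intro k z hz hz' u
    have hi : HasFDerivAt (fun x : E' => (z.1, x)) (ContinuousLinearMap.inr ℝ E E') z.2 :=
      hasFDerivAt_prodMk_right z.1 z.2
    have e1 := push_mfderiv_comp (M := E') (M' := E × E') (g := ψ) (y := z) rfl
      hi.differentiableAt.mdifferentiableAt ((hψs z hz hz').mdifferentiableAt (by simp)) u
    have e2 := push_mfderiv_comp (M := E') (g := fun q' => a (c.symm z.1, q')) rfl
      (mdifferentiableAt_extChartAt_symm_of_mem hz')
      ((ha₂ (c.symm z.1)).mdifferentiableAt (by simp)) u
    rw [mfderiv_eq_fderiv, hi.fderiv] at e1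
    exact e1.trans e2.symm
  have hd₁ := hP₁.differentiableAt_inChart ht
  have hd₂ := hP₂.differentiableAt_inChart ht'
  obtain ⟨D, hD, -⟩ := hasFDerivAt_prodBivectorE (z := (c p, c' q)) hd₁ hd₂
  have key := schoutenSelf_param (ψ := ψ) (y₀ := (c p, c' q)) (P := Q)
    (P' := prodBivectorE (P₁.inChart p) (P₂.inChart q)) (hψs _ ht ht') hQ hD.differentiableAt (by
      have hz1 : ∀ᶠ z : E × E' in 𝓝 (c p, c' q), z.1 ∈ c.target :=
        continuousAt_fst.preimage_mem_nhds (extChartAt_target_mem_nhds_of_mem ht)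
      have hz2 : ∀ᶠ z : E × E' in 𝓝 (c p, c' q), z.2 ∈ c'.target :=
        continuousAt_snd.preimage_mem_nhds (extChartAt_target_mem_nhds_of_mem ht')
      filter_upwards [hz1, hz2] with z hz hz'
      refine (h (c.symm z.1) (c'.symm z.2)).trans ?_
      rw [← P₁.push_inChart hz, ← P₂.push_inChart hz']
      exact congrArg₂ (fun u v : Multivector 2 E'' => u + v) (hp1 z hz hz' _).symm
        (hp2 z hz hz' _).symm)
  rw [schoutenSelfE_prodBivectorE hd₁ hd₂] at key
  have key2 := key.trans (congrArg₂ (fun u v : Multivector 3 E'' => u + v)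
    (hp1 (c p, c' q) ht ht' (schoutenSelfE (P₁.inChart p) (c p)))
    (hp2 (c p, c' q) ht ht' (schoutenSelfE (P₂.inChart q) (c' q))))
  have e : ∀ p' q', p' = p → q' = q →
      schoutenSelf Q (a (p', q')) =
      (Multivector.push (mfderiv 𝓘(ℝ, E) 𝓘(ℝ, E'') (fun p => a (p, q')) p')
        (schoutenSelf P₁ p : Multivector 3 E)
      + Multivector.push (mfderiv 𝓘(ℝ, E') 𝓘(ℝ, E'') (fun q => a (p', q)) q')
        (schoutenSelf P₂ q : Multivector 3 E') : Multivector 3 E'') →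
      schoutenSelf Q (a (p, q)) =
      Multivector.push (mfderiv 𝓘(ℝ, E) 𝓘(ℝ, E'') (fun p' => a (p', q)) p) (schoutenSelf P₁ p)
      + Multivector.push (mfderiv 𝓘(ℝ, E') 𝓘(ℝ, E'') (fun q' => a (p, q')) q)
        (schoutenSelf P₂ q) := by
    rintro p' q' rfl rfl h
    exact h
  exact e _ _ hcp hcq key2

end Charts

/-! ### Smooth bivector fields from orbit maps -/

section Smoothness

variable {E : Type*} [NormedAddCommGroup E] [NormedSpace ℝ E] [FiniteDimensional ℝ E]
  {M : Type*} [TopologicalSpace M] [ChartedSpace E M] [IsManifold 𝓘(ℝ, E) ∞ M]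
  {F : Type*} [NormedAddCommGroup F] [NormedSpace ℝ F] [FiniteDimensional ℝ F]
  {H : Type*} [TopologicalSpace H] [ChartedSpace F H] [IsManifold 𝓘(ℝ, F) ∞ H]

/-- Composition with a linear map, in a form that can be applied to spaces of alternating maps by
giving `Y` and `Z` explicitly. -/
theorem _root_.ContDiffOn.clm_comp_left {X Y Z : Type*} [NormedAddCommGroup X] [NormedSpace ℝ X]
    [NormedAddCommGroup Y] [NormedSpace ℝ Y] [NormedAddCommGroup Z] [NormedSpace ℝ Z]
    {n : WithTop ℕ∞} {s : Set X} (L : Y →L[ℝ] Z) {f : X → Y} (hf : ContDiffOn ℝ n f s) :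
    ContDiffOn ℝ n (fun x => L (f x)) s :=
  L.contDiff.comp_contDiffOn hf

theorem contDiffOn_pair {X : Type*} [NormedAddCommGroup X] [NormedSpace ℝ X]
    {n : WithTop ℕ∞} {s : Set X} (w : F [⋀^Fin 2]→L[ℝ] ℝ) {a b : X → F}
    (ha : ContDiffOn ℝ n a s) (hb : ContDiffOn ℝ n b s) :
    ContDiffOn ℝ n (fun x => w ![a x, b x]) s := by
  have h1 : ContDiffOn ℝ n (fun x => flatCLM F w (a x)) s :=
    (flatCLM F w).contDiff.comp_contDiffOn ha
  exact h1.clm_apply hb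

/-- If `a : H × M → M` is smooth with `a (e, ·) = id`, then the images of a bivector at `e` under
the orbit maps `a (·, p)` form a smooth bivector field on `M`. -/
theorem isSmooth_push_orbitMap {a : H × M → M}
    (ha : ContMDiff (𝓘(ℝ, F).prod 𝓘(ℝ, E)) 𝓘(ℝ, E) ∞ a) {e : H} (he : ∀ p, a (e, p) = p)
    (t : Multivector 2 (TangentSpace 𝓘(ℝ, F) e)) {u : MultivectorField E M 2}
    (hu : ∀ p, u p = Multivector.push (mfderiv 𝓘(ℝ, F) 𝓘(ℝ, E) (fun h => a (h, p)) e) t) :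
    u.IsSmooth := by
  intro x₀
  set c := extChartAt 𝓘(ℝ, E) x₀ with hc
  set k := extChartAt 𝓘(ℝ, F) e with hk
  have hke : k e ∈ k.target := mem_extChartAt_target e
  have hks : k.symm (k e) = e := k.left_inv (mem_extChartAt_source e)
  -- in charts the field is `y ↦ Λ²(D₂Φ (y, k e) ∘ K) t`
  set Φ : E → F → E := fun y x => c (a (k.symm x, c.symm y)) with hΦ
  have hΦs : ∀ y ∈ c.target, ContDiffAt ℝ ∞ (Function.uncurry Φ) (y, k e) := fun y hy => by
    have h1 : ContMDiffAt 𝓘(ℝ, E × F) 𝓘(ℝ, E) ∞ (fun z : E × F => c.symm z.1) (y, k e) :=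
      (contMDiffAt_extChartAt_symm_of_mem hy).comp (y, k e) contDiff_fst.contMDiff.contMDiffAt
    have h2 : ContMDiffAt 𝓘(ℝ, E × F) 𝓘(ℝ, F) ∞ (fun z : E × F => k.symm z.2) (y, k e) :=
      (contMDiffAt_extChartAt_symm_of_mem hke).comp (y, k e) contDiff_snd.contMDiff.contMDiffAt
    have h3 : ContMDiffAt 𝓘(ℝ, E × F) 𝓘(ℝ, E) ∞
        (fun z : E × F => a (k.symm z.2, c.symm z.1)) (y, k e) :=
      ha.contMDiffAt.comp (y, k e) (h2.prodMk h1)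
    have h4 : a (k.symm (k e), c.symm y) ∈ c.source := by
      rw [hks, he]
      exact c.map_target hy
    exact (ContMDiffAt.comp (y, k e) (contMDiffAt_extChartAt_of_mem h4) h3).contDiffAt
  have hD : ContDiffOn ℝ ∞ (fun y => fderiv ℝ (Φ y) (k e)) c.target := fun y hy =>
    (ContDiffAt.fderiv (hΦs y hy) contDiffAt_const (by simp)).contDiffWithinAt
  set K : F →L[ℝ] F := mfderiv 𝓘(ℝ, F) 𝓘(ℝ, F) k e with hK
  have hpush : ContDiffOn ℝ ∞ (fun y => Multivector.push (V := F)
      ((fderiv ℝ (Φ y) (k e)).comp K) t) c.target := by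
    have hα : ∀ α : E →L[ℝ] ℝ, ContDiffOn ℝ ∞
        (fun y => α.comp ((fderiv ℝ (Φ y) (k e)).comp K)) c.target := fun α =>
      contDiffOn_const.clm_comp (hD.clm_comp contDiffOn_const)
    refine contDiffOn_of_pair fun α β => ?_
    refine (contDiffOn_pair (F := F →L[ℝ] ℝ) t (hα α) (hα β)).congr fun y _ => ?_
    exact Multivector.push_pair _ _ _ _
  refine hpush.congr fun y hy => ?_
  have hys : c.symm y ∈ c.source := c.map_target hy
  have hay : ContMDiff 𝓘(ℝ, F) 𝓘(ℝ, E) ∞ fun h => a (h, c.symm y) :=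
    ha.comp (contMDiff_id.prodMk contMDiff_const)
  have e1 := push_mfderiv_comp (f := fun h => a (h, c.symm y)) (g := c) (he (c.symm y))
    (hay.mdifferentiableAt (by simp)) (mdifferentiableAt_extChartAt_of_mem hys) t
  have hΦd : DifferentiableAt ℝ (Φ y) (k e) := by
    have : DifferentiableAt ℝ (fun x => Function.uncurry Φ (y, x)) (k e) :=
      DifferentiableAt.comp (g := Function.uncurry Φ) (k e) ((hΦs y hy).differentiableAt (by simp))
        ((differentiableAt_const y).prodMk differentiableAt_id)
    exact this
  have e2 := push_mfderiv_comp (M := H) (M' := F) (M'' := E) (f := k) (g := Φ y) (y := k e) rfl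
    (mdifferentiableAt_extChartAt_of_mem (mem_extChartAt_source e)) hΦd.mdifferentiableAt t
  have hev : (c ∘ fun h => a (h, c.symm y)) =ᶠ[𝓝 e] Φ y ∘ k := by
    filter_upwards [extChartAt_source_mem_nhds (I := 𝓘(ℝ, F)) e] with h hh
    change _ = c (a (k.symm (k h), c.symm y))
    rw [k.left_inv hh]
    rfl
  rw [hev.mfderiv_eq] at e1
  rw [mfderiv_eq_fderiv] at e2
  have e0 : u.inChart x₀ y = Multivector.push (mfderiv 𝓘(ℝ, E) 𝓘(ℝ, E) c (c.symm y))
      (u (c.symm y)) := rfl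
  rw [hu] at e0
  exact e0.trans (e1.trans e2.symm)

end Smoothness

/-! ### Symplectic forms and nondegenerate Poisson structures -/

section Symplectic

variable {E : Type*} [NormedAddCommGroup E] [NormedSpace ℝ E] [FiniteDimensional ℝ E]
  {M : Type*} [TopologicalSpace M] [ChartedSpace E M]

theorem IsSymplectic.isInvertible_flat {w : FormField E M 2} (hw : IsSymplectic w) (p : M) :
    (flat (w p)).IsInvertible :=
  TwistDeformation.isInvertible_flat (hw.nondegenerate p)

variable [IsManifold 𝓘(ℝ, E) ∞ M]

theorem isInvertible_flat_inChart {w : FormField E M 2} (hw : ∀ p, (flat (w p)).IsInvertible)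
    {x₀ : M} {y : E} (hy : y ∈ (extChartAt 𝓘(ℝ, E) x₀).target) :
    (flat (w.inChart x₀ y)).IsInvertible :=
  isInvertible_flat_comp (W := E) (hw _)
    (mfderiv_extChartAt_apply hy) (mfderiv_extChartAt_symm_apply hy)

theorem inducedPoisson_inChart {w : FormField E M 2} (hw : ∀ p, (flat (w p)).IsInvertible)
    {x₀ : M} {y : E} (hy : y ∈ (extChartAt 𝓘(ℝ, E) x₀).target) :
    (inducedPoisson w).inChart x₀ y = inducedBivector (w.inChart x₀ y) :=
  push_inducedBivector (W := E) (hw _)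
    (mfderiv_extChartAt_apply hy) (mfderiv_extChartAt_symm_apply hy)

theorem isSmooth_inducedPoisson {w : FormField E M 2} (hw : ∀ p, (flat (w p)).IsInvertible)
    (hs : w.IsSmooth) : (inducedPoisson w).IsSmooth := by
  intro x₀
  refine ContDiffOn.congr ?_ fun y hy => inducedPoisson_inChart hw hy
  refine contDiffOn_of_pair fun α β => ?_
  have hflat : ContDiffOn ℝ ∞ (fun y => flatCLM E (w.inChart x₀ y))
      (extChartAt 𝓘(ℝ, E) x₀).target :=
    ContDiffOn.clm_comp_left (Y := E [⋀^Fin 2]→L[ℝ] ℝ) (Z := E →L[ℝ] E →L[ℝ] ℝ) _ (hs x₀)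
  have hinv : ContDiffOn ℝ ∞ (fun y => (flatCLM E (w.inChart x₀ y)).inverse α)
      (extChartAt 𝓘(ℝ, E) x₀).target := fun y hy => by
    have h1 := (ContinuousLinearMap.IsInvertible.contDiffAt_map_inverse (n := ∞)
      (isInvertible_flat_inChart hw hy)).comp_contDiffWithinAt y (hflat y hy)
    exact h1.clm_apply contDiffWithinAt_const
  refine (β.contDiff.comp_contDiffOn hinv).congr fun y hy => ?_
  rw [← Multivector.apply_sharp, sharp_inducedBivector_eq_inverse (isInvertible_flat_inChart hw hy)]
  rfl

omit [FiniteDimensional ℝ E] [IsManifold 𝓘(ℝ, E) ∞ M] in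
theorem differentiableAt_formInChart {w : FormField E M 2} (hs : w.IsSmooth) {x₀ : M} {y : E}
    (hy : y ∈ (extChartAt 𝓘(ℝ, E) x₀).target) : DifferentiableAt ℝ (w.inChart x₀) y :=
  ((hs x₀).contDiffAt (extChartAt_target_mem_nhds_of_mem hy)).differentiableAt (by simp)

theorem schoutenSelfE_inducedPoisson {w : FormField E M 2}
    (hw : ∀ p, (flat (w p)).IsInvertible) (hs : w.IsSmooth) {x₀ : M} {y : E}
    (hy : y ∈ (extChartAt 𝓘(ℝ, E) x₀).target) (α β γ : E →L[ℝ] ℝ) :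
    schoutenSelfE ((inducedPoisson w).inChart x₀) y ![α, β, γ] =
      2 * extDeriv (w.inChart x₀) y ![((inducedPoisson w).inChart x₀ y).sharp α,
        ((inducedPoisson w).inChart x₀ y).sharp β, ((inducedPoisson w).inChart x₀ y).sharp γ] := by
  refine schoutenSelfE_eq_extDeriv (differentiableAt_formInChart hs hy)
    ((isSmooth_inducedPoisson hw hs).differentiableAt_inChart hy) ?_ α β γ
  filter_upwards [extChartAt_target_mem_nhds_of_mem hy] with z hz α
  rw [inducedPoisson_inChart hw hz, flat_sharp_inducedBivector (isInvertible_flat_inChart hw hz)]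

/-- The bivector field of a symplectic form is Poisson, since its Schouten bracket corresponds to
the exterior derivative of the form. -/
theorem IsSymplectic.isPoisson {w : FormField E M 2} (hw : IsSymplectic w) :
    IsPoisson (inducedPoisson w) := by
  refine ⟨isSmooth_inducedPoisson hw.isInvertible_flat hw.smooth, fun p => ?_⟩
  have h : schoutenSelfE ((inducedPoisson w).inChart p) (extChartAt 𝓘(ℝ, E) p p) = 0 :=
    triple_ext fun α β γ => by
      have ht := mem_extChartAt_target (I := 𝓘(ℝ, E)) p
      rw [schoutenSelfE_inducedPoisson hw.isInvertible_flat hw.smooth ht, hw.closed p _ ht]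
      simp
  rw [schoutenSelf, h]
  rfl

/-- A nondegenerate Poisson structure is induced by a unique symplectic form. -/
theorem existsUnique_isSymplectic {P : MultivectorField E M 2} (hP : IsPoisson P)
    (hn : ∀ p, (P p).Nondegenerate) :
    ∃! w : FormField E M 2, IsSymplectic w ∧ inducedPoisson w = P := by
  set w : FormField E M 2 := fun p => inverseForm (P p) (hn p) with hwdef
  have hw : ∀ p, (flat (w p)).IsInvertible := fun p => isInvertible_flat_inverseForm _ _
  have hwP : inducedPoisson w = P := funext fun p => inducedBivector_inverseForm _ _
  have hnE : ∀ {x₀ : M} {y : E}, y ∈ (extChartAt 𝓘(ℝ, E) x₀).target →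
      P.inChart x₀ y = inducedBivector (w.inChart x₀ y) := fun hy => by
    rw [← hwP, inducedPoisson_inChart hw hy]
  have hs : w.IsSmooth := by
    intro x₀
    refine contDiffOn_of_pair fun a b => ?_
    have hsharp : ContDiffOn ℝ ∞ (fun y => sharpCLM E (P.inChart x₀ y))
        (extChartAt 𝓘(ℝ, E) x₀).target :=
      ContDiffOn.clm_comp_left (Y := Multivector 2 E) (Z := (E →L[ℝ] ℝ) →L[ℝ] E) _ (hP.smooth x₀)
    have hinv : ∀ y ∈ (extChartAt 𝓘(ℝ, E) x₀).target,
        (sharpCLM E (P.inChart x₀ y)).IsInvertible ∧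
        (sharpCLM E (P.inChart x₀ y)).inverse = flat (w.inChart x₀ y) := fun y hy => by
      have hi := isInvertible_flat_inChart hw hy
      have h1 : (sharpCLM E (P.inChart x₀ y)).comp (flat (w.inChart x₀ y)) =
          ContinuousLinearMap.id ℝ E := by
        ext v
        change (P.inChart x₀ y).sharp (flat (w.inChart x₀ y) v) = v
        rw [hnE hy, sharp_inducedBivector _ hi]
      have h2 : (flat (w.inChart x₀ y)).comp (sharpCLM E (P.inChart x₀ y)) =
          ContinuousLinearMap.id ℝ (E →L[ℝ] ℝ) := by
        ext1 α
        change flat (w.inChart x₀ y) ((P.inChart x₀ y).sharp α) = α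
        rw [hnE hy, flat_sharp_inducedBivector hi]
      exact ⟨ContinuousLinearMap.IsInvertible.of_inverse h1 h2,
        ContinuousLinearMap.inverse_eq h1 h2⟩
    have hsm : ContDiffOn ℝ ∞ (fun y => (sharpCLM E (P.inChart x₀ y)).inverse a b)
        (extChartAt 𝓘(ℝ, E) x₀).target := fun y hy => by
      have h1 := (ContinuousLinearMap.IsInvertible.contDiffAt_map_inverse (n := ∞)
        (hinv y hy).1).comp_contDiffWithinAt y (hsharp y hy)
      exact (h1.clm_apply contDiffWithinAt_const).clm_apply contDiffWithinAt_const
    refine hsm.congr fun y hy => ?_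
    rw [(hinv y hy).2, flat_apply]
  have hsymp : IsSymplectic w := by
    refine ⟨hs, fun x₀ y hy => triple_ext fun a b c => ?_, fun p v hv => ?_⟩
    · have hnd := nondegenerate_inducedBivector (isInvertible_flat_inChart hw hy)
      rw [← hnE hy] at hnd
      obtain ⟨α, rfl⟩ := hnd.2 a
      obtain ⟨β, rfl⟩ := hnd.2 b
      obtain ⟨γ, rfl⟩ := hnd.2 c
      have h := schoutenSelfE_inducedPoisson hw hs hy α β γ
      rw [hwP, schoutenSelfE_inChart_eq_zero hP hy] at h
      have h0 : (0 : Multivector 3 E) ![α, β, γ] = 0 := rfl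
      rw [h0] at h
      change _ = (0 : ℝ)
      linarith
    · apply (hw p).bijective.1
      rw [map_zero]
      ext v'
      exact hv v'
  refine ⟨w, ⟨hsymp, hwP⟩, fun w' ⟨hw', hwP'⟩ => funext fun p => ?_⟩
  exact inducedBivector_injOn (hw'.isInvertible_flat p) (hw p)
    (congrFun (hwP'.trans hwP.symm) p)

end Symplectic

/-! ### The group law in the chart at the identity -/

section PartialDerivatives

variable {X Y Z : Type*} [NormedAddCommGroup X] [NormedSpace ℝ X]
  [NormedAddCommGroup Y] [NormedSpace ℝ Y] [NormedAddCommGroup Z] [NormedSpace ℝ Z]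
  {f : X × Y → Z} {f' : X × Y →L[ℝ] Z} {x : X} {y : Y}

theorem _root_.HasFDerivAt.partial_fst (hf : HasFDerivAt f f' (x, y)) :
    HasFDerivAt (fun x => f (x, y)) (f'.comp (ContinuousLinearMap.inl ℝ X Y)) x :=
  HasFDerivAt.comp (g := f) x hf (hasFDerivAt_prodMk_left x y)

theorem _root_.HasFDerivAt.partial_snd (hf : HasFDerivAt f f' (x, y)) :
    HasFDerivAt (fun y => f (x, y)) (f'.comp (ContinuousLinearMap.inr ℝ X Y)) y :=
  HasFDerivAt.comp (g := f) y hf (hasFDerivAt_prodMk_right x y)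

end PartialDerivatives

section ChartMultiplication

variable {F : Type*} [NormedAddCommGroup F] [NormedSpace ℝ F]
  {G : Type*} [TopologicalSpace G] [ChartedSpace F G] [Group G] [LieGroup 𝓘(ℝ, F) ∞ G]

theorem contMDiff_mul_pair :
    ContMDiff (𝓘(ℝ, F).prod 𝓘(ℝ, F)) 𝓘(ℝ, F) ∞ fun z : G × G => z.1 * z.2 :=
  contMDiff_mul 𝓘(ℝ, F) ∞

theorem contMDiff_mulLeft (g : G) : ContMDiff 𝓘(ℝ, F) 𝓘(ℝ, F) ∞ fun h : G => g * h :=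
  contMDiff_mul_left

theorem contMDiff_mulRight (g : G) : ContMDiff 𝓘(ℝ, F) 𝓘(ℝ, F) ∞ fun h : G => h * g :=
  contMDiff_mul_right

theorem contMDiff_conj (g : G) : ContMDiff 𝓘(ℝ, F) 𝓘(ℝ, F) ∞ fun h : G => g * h * g⁻¹ :=
  (contMDiff_mulRight g⁻¹).comp (contMDiff_mulLeft g)

variable (F G) in
/-- The chart at the identity. -/
noncomputable def chartOne : PartialEquiv G F :=
  extChartAt 𝓘(ℝ, F) (1 : G)

variable (F G) in
/-- The coordinates of the identity. -/
noncomputable def coordOne : F :=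
  chartOne F G 1

variable (F G) in
/-- The multiplication of `G` in the chart at the identity. -/
noncomputable def chartMul (z : F × F) : F :=
  chartOne F G ((chartOne F G).symm z.1 * (chartOne F G).symm z.2)

variable (F G) in
/-- The conjugation `(g, h) ↦ g h g⁻¹` in the chart at the identity. -/
noncomputable def chartConj (x y : F) : F :=
  chartOne F G ((chartOne F G).symm x * (chartOne F G).symm y * ((chartOne F G).symm x)⁻¹)

variable (F G) in
/-- The adjoint action in the chart at the identity. -/
noncomputable def chartAd (x : F) : F →L[ℝ] F :=
  fderiv ℝ (chartConj F G x) (coordOne F G)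

omit [LieGroup 𝓘(ℝ, F) ∞ G] in
theorem one_mem_chartOne_source : (1 : G) ∈ (chartOne F G).source :=
  mem_extChartAt_source 1

omit [LieGroup 𝓘(ℝ, F) ∞ G] in
theorem coordOne_mem_target : coordOne F G ∈ (chartOne F G).target :=
  mem_extChartAt_target (1 : G)

omit [LieGroup 𝓘(ℝ, F) ∞ G] in
theorem chartOne_symm_coordOne : (chartOne F G).symm (coordOne F G) = 1 :=
  (chartOne F G).left_inv one_mem_chartOne_source

omit [LieGroup 𝓘(ℝ, F) ∞ G] in
theorem eventually_mem_chartOne_target :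
    ∀ᶠ x in 𝓝 (coordOne F G), x ∈ (chartOne F G).target :=
  extChartAt_target_mem_nhds_of_mem coordOne_mem_target

omit [LieGroup 𝓘(ℝ, F) ∞ G] in
theorem chartMul_coordOne_right {x : F} (hx : x ∈ (chartOne F G).target) :
    chartMul F G (x, coordOne F G) = x := by
  rw [chartMul, chartOne_symm_coordOne, mul_one]
  exact (chartOne F G).right_inv hx

omit [LieGroup 𝓘(ℝ, F) ∞ G] in
theorem chartMul_coordOne_left {x : F} (hx : x ∈ (chartOne F G).target) :
    chartMul F G (coordOne F G, x) = x := by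
  rw [chartMul, chartOne_symm_coordOne, one_mul]
  exact (chartOne F G).right_inv hx

omit [LieGroup 𝓘(ℝ, F) ∞ G] in
theorem chartConj_coordOne_right (x : F) :
    chartConj F G x (coordOne F G) = coordOne F G := by
  rw [chartConj, chartOne_symm_coordOne, mul_one, mul_inv_cancel]
  rfl

omit [LieGroup 𝓘(ℝ, F) ∞ G] in
theorem chartConj_coordOne_left {y : F} (hy : y ∈ (chartOne F G).target) :
    chartConj F G (coordOne F G) y = y := by
  rw [chartConj, chartOne_symm_coordOne, one_mul, inv_one, mul_one]
  exact (chartOne F G).right_inv hy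

theorem contMDiffAt_chartOne_symm_comp {X : Type*} [NormedAddCommGroup X] [NormedSpace ℝ X]
    (L : X →L[ℝ] F) {z : X} (hz : L z ∈ (chartOne F G).target) :
    ContMDiffAt 𝓘(ℝ, X) 𝓘(ℝ, F) ∞ (fun z => (chartOne F G).symm (L z)) z :=
  ContMDiffAt.comp z (contMDiffAt_extChartAt_symm_of_mem hz) L.contDiff.contMDiff.contMDiffAt

theorem contDiffAt_chartMul {z : F × F} (h₁ : z.1 ∈ (chartOne F G).target)
    (h₂ : z.2 ∈ (chartOne F G).target)
    (h : (chartOne F G).symm z.1 * (chartOne F G).symm z.2 ∈ (chartOne F G).source) :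
    ContDiffAt ℝ ∞ (chartMul F G) z := by
  have a := contMDiffAt_chartOne_symm_comp (G := G) (ContinuousLinearMap.fst ℝ F F) h₁
  have b := contMDiffAt_chartOne_symm_comp (G := G) (ContinuousLinearMap.snd ℝ F F) h₂
  exact (ContMDiffAt.comp z (contMDiffAt_extChartAt_of_mem h) (a.mul b)).contDiffAt

theorem contDiffAt_chartConj {z : F × F} (h₁ : z.1 ∈ (chartOne F G).target)
    (h₂ : z.2 ∈ (chartOne F G).target)
    (h : (chartOne F G).symm z.1 * (chartOne F G).symm z.2 * ((chartOne F G).symm z.1)⁻¹ ∈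
      (chartOne F G).source) :
    ContDiffAt ℝ ∞ (Function.uncurry (chartConj F G)) z := by
  have a := contMDiffAt_chartOne_symm_comp (G := G) (ContinuousLinearMap.fst ℝ F F) h₁
  have b := contMDiffAt_chartOne_symm_comp (G := G) (ContinuousLinearMap.snd ℝ F F) h₂
  exact (ContMDiffAt.comp z (contMDiffAt_extChartAt_of_mem h) ((a.mul b).mul a.inv)).contDiffAt

theorem contDiffAt_chartMul_right {x : F} (hx : x ∈ (chartOne F G).target) :
    ContDiffAt ℝ ∞ (chartMul F G) (x, coordOne F G) := by
  refine contDiffAt_chartMul hx coordOne_mem_target ?_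
  rw [chartOne_symm_coordOne, mul_one]
  exact (chartOne F G).map_target hx

theorem contDiffAt_chartMul_left {x : F} (hx : x ∈ (chartOne F G).target) :
    ContDiffAt ℝ ∞ (chartMul F G) (coordOne F G, x) := by
  refine contDiffAt_chartMul coordOne_mem_target hx ?_
  rw [chartOne_symm_coordOne, one_mul]
  exact (chartOne F G).map_target hx

theorem contDiffAt_chartConj_right {x : F} (hx : x ∈ (chartOne F G).target) :
    ContDiffAt ℝ ∞ (Function.uncurry (chartConj F G)) (x, coordOne F G) := by
  refine contDiffAt_chartConj hx coordOne_mem_target ?_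
  change (chartOne F G).symm x * (chartOne F G).symm (coordOne F G) * _ ∈ _
  rw [chartOne_symm_coordOne, mul_one, mul_inv_cancel]
  exact one_mem_chartOne_source

theorem hasFDerivAt_chartConj {x : F} (hx : x ∈ (chartOne F G).target) :
    HasFDerivAt (chartConj F G x) (chartAd F G x) (coordOne F G) := by
  have h : DifferentiableAt ℝ (fun y => Function.uncurry (chartConj F G) (x, y))
      (coordOne F G) :=
    DifferentiableAt.comp (g := Function.uncurry (chartConj F G)) (coordOne F G)
      ((contDiffAt_chartConj_right hx).differentiableAt (by simp))
      ((differentiableAt_const x).prodMk differentiableAt_id)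
  exact DifferentiableAt.hasFDerivAt h

theorem differentiableAt_chartAd : DifferentiableAt ℝ (chartAd F G) (coordOne F G) := by
  have h : ContDiffAt ℝ ∞ (fun x => fderiv ℝ (chartConj F G x) (coordOne F G)) (coordOne F G) :=
    ContDiffAt.fderiv (contDiffAt_chartConj_right coordOne_mem_target) contDiffAt_const (by simp)
  exact h.differentiableAt (by simp)

theorem chartAd_coordOne : chartAd F G (coordOne F G) = ContinuousLinearMap.id ℝ F := by
  refine (hasFDerivAt_chartConj coordOne_mem_target).unique
    ((hasFDerivAt_id _).congr_of_eventuallyEq ?_)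
  filter_upwards [eventually_mem_chartOne_target] with y hy
  exact chartConj_coordOne_left hy

theorem fderiv_chartMul_left_apply (Z : F) :
    fderiv ℝ (chartMul F G) (coordOne F G, coordOne F G) (Z, 0) = Z := by
  have h1 : HasFDerivAt (fun x => chartMul F G (x, coordOne F G)) _ (coordOne F G) :=
    (((contDiffAt_chartMul_left (G := G) coordOne_mem_target).differentiableAt
      (by simp)).hasFDerivAt).partial_fst
  have h2 : HasFDerivAt (fun x => chartMul F G (x, coordOne F G)) (ContinuousLinearMap.id ℝ F)
      (coordOne F G) := by
    refine (hasFDerivAt_id _).congr_of_eventuallyEq ?_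
    filter_upwards [eventually_mem_chartOne_target] with y hy
    exact chartMul_coordOne_right hy
  exact DFunLike.congr_fun (h1.unique h2) Z

theorem fderiv_chartMul_right_apply (Z : F) :
    fderiv ℝ (chartMul F G) (coordOne F G, coordOne F G) (0, Z) = Z := by
  have h1 : HasFDerivAt (fun x => chartMul F G (coordOne F G, x)) _ (coordOne F G) :=
    (((contDiffAt_chartMul_left (G := G) coordOne_mem_target).differentiableAt
      (by simp)).hasFDerivAt).partial_snd
  have h2 : HasFDerivAt (fun x => chartMul F G (coordOne F G, x)) (ContinuousLinearMap.id ℝ F)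
      (coordOne F G) := by
    refine (hasFDerivAt_id _).congr_of_eventuallyEq ?_
    filter_upwards [eventually_mem_chartOne_target] with y hy
    exact chartMul_coordOne_left hy
  exact DFunLike.congr_fun (h1.unique h2) Z

/-- First derivative at `h = 1` of the relation `g h = (g h g⁻¹) g`. -/
theorem fderiv_chartMul_chartAd :
    ∀ᶠ x in 𝓝 (coordOne F G), ∀ Y,
      fderiv ℝ (chartMul F G) (x, coordOne F G) (0, Y) =
        fderiv ℝ (chartMul F G) (coordOne F G, x) (chartAd F G x Y, 0) := by
  filter_upwards [eventually_mem_chartOne_target] with x hx Y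
  have h1 : HasFDerivAt (fun y => chartMul F G (x, y)) _ (coordOne F G) :=
    (((contDiffAt_chartMul_right (G := G) hx).differentiableAt
      (by simp)).hasFDerivAt).partial_snd
  have h2 : HasFDerivAt (chartMul F G) (fderiv ℝ (chartMul F G) (coordOne F G, x))
      (chartConj F G x (coordOne F G), x) := by
    rw [chartConj_coordOne_right]
    exact ((contDiffAt_chartMul_left (G := G) hx).differentiableAt (by simp)).hasFDerivAt
  have h3 : HasFDerivAt (fun y => chartMul F G (chartConj F G x y, x)) _ (coordOne F G) :=
    HasFDerivAt.comp (g := chartMul F G) (coordOne F G) h2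
      ((hasFDerivAt_chartConj hx).prodMk (hasFDerivAt_const x _))
  have heq : (fun y => chartMul F G (x, y)) =ᶠ[𝓝 (coordOne F G)]
      fun y => chartMul F G (chartConj F G x y, x) := by
    have hc : ContinuousAt (fun y : F => (chartOne F G).symm x * (chartOne F G).symm y *
        ((chartOne F G).symm x)⁻¹) (coordOne F G) :=
      (((contMDiff_conj (F := F) ((chartOne F G).symm x)).contMDiffAt).comp (coordOne F G)
        (contMDiffAt_chartOne_symm_comp (G := G) (ContinuousLinearMap.id ℝ F)
          coordOne_mem_target)).continuousAt
    have hs : ∀ᶠ y in 𝓝 (coordOne F G), (chartOne F G).symm x * (chartOne F G).symm y *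
        ((chartOne F G).symm x)⁻¹ ∈ (chartOne F G).source := by
      refine hc.preimage_mem_nhds ((isOpen_extChartAt_source (1 : G)).mem_nhds ?_)
      rw [chartOne_symm_coordOne, mul_one, mul_inv_cancel]
      exact one_mem_chartOne_source
    filter_upwards [hs] with y hy
    have e : (chartOne F G).symm (chartConj F G x y) = _ := (chartOne F G).left_inv hy
    simp only [chartMul, e]
    rw [inv_mul_cancel_right]
  have h4 := h1.unique (h3.congr_of_eventuallyEq heq)
  exact DFunLike.congr_fun h4 Y

/-- Second derivative of the relation `g h = (g h g⁻¹) g`: the derivative of the adjoint action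
is the antisymmetrisation of the second derivative of the multiplication. -/
theorem fderiv_chartAd (X Y : F) :
    fderiv ℝ (chartAd F G) (coordOne F G) X Y =
      fderiv ℝ (fderiv ℝ (chartMul F G)) (coordOne F G, coordOne F G) (X, 0) (0, Y)
      - fderiv ℝ (fderiv ℝ (chartMul F G)) (coordOne F G, coordOne F G) (Y, 0) (0, X) := by
  set o := coordOne F G
  have hm : ContDiffAt ℝ ∞ (chartMul F G) (o, o) := contDiffAt_chartMul_left coordOne_mem_target
  have hm2 : HasFDerivAt (fderiv ℝ (chartMul F G)) (fderiv ℝ (fderiv ℝ (chartMul F G)) (o, o))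
      (o, o) :=
    ((hm.fderiv_right (m := ∞) (by simp)).differentiableAt (by simp)).hasFDerivAt
  have h1 : HasFDerivAt (fun x => fderiv ℝ (chartMul F G) (x, o)) _ o :=
    hm2.partial_fst
  have h1' := h1.clm_apply (hasFDerivAt_const ((0, Y) : F × F) o)
  have h2 : HasFDerivAt (fun x => fderiv ℝ (chartMul F G) (o, x)) _ o :=
    hm2.partial_snd
  have hA : HasFDerivAt (chartAd F G) (fderiv ℝ (chartAd F G) o) o :=
    differentiableAt_chartAd.hasFDerivAt
  have hAY := hA.clm_apply (hasFDerivAt_const Y o)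
  have h2' := h2.clm_apply (hAY.prodMk (hasFDerivAt_const (0 : F) o))
  have h3 := h1'.unique (h2'.congr_of_eventuallyEq (by
    filter_upwards [fderiv_chartMul_chartAd (F := F) (G := G)] with x hx
    exact hx Y))
  have h4 := DFunLike.congr_fun h3 X
  have hsymm := (hm.isSymmSndFDerivAt (by
    rw [minSmoothness_of_isRCLikeNormedField]
    exact WithTop.coe_le_coe.2 le_top)) (0, X) (Y, 0)
  have hl := fderiv_chartMul_left_apply (F := F) (G := G) (fderiv ℝ (chartAd F G) o X Y)
  have hid : chartAd F G o = ContinuousLinearMap.id ℝ F := chartAd_coordOne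
  simp [hid] at h4
  rw [h4, ← hsymm, hl]
  abel

end ChartMultiplication

/-! ### The adjoint action and its derivative -/

section Adjoint

variable {F : Type*} [NormedAddCommGroup F] [NormedSpace ℝ F]
  {G : Type*} [TopologicalSpace G] [ChartedSpace F G] [Group G] [LieGroup 𝓘(ℝ, F) ∞ G]

/-- The derivative of a map between manifolds, with the tangent spaces identified with the model
spaces, so that the derivatives at points that are only propositionally equal have the same type. -/
noncomputable def modelDeriv (E E' : Type*) {M M' : Type*}
    [NormedAddCommGroup E] [NormedSpace ℝ E] [TopologicalSpace M] [ChartedSpace E M]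
    [NormedAddCommGroup E'] [NormedSpace ℝ E'] [TopologicalSpace M'] [ChartedSpace E' M']
    (f : M → M') (x : M) : E →L[ℝ] E' :=
  mfderiv 𝓘(ℝ, E) 𝓘(ℝ, E') f x

section ModelDeriv

variable {E E' E'' M M' M'' : Type*}
  [NormedAddCommGroup E] [NormedSpace ℝ E] [TopologicalSpace M] [ChartedSpace E M]
  [NormedAddCommGroup E'] [NormedSpace ℝ E'] [TopologicalSpace M'] [ChartedSpace E' M']
  [NormedAddCommGroup E''] [NormedSpace ℝ E''] [TopologicalSpace M''] [ChartedSpace E'' M'']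

theorem modelDeriv_comp {f : M → M'} {g : M' → M''} {x : M} {y : M'} (hy : f x = y)
    (hf : MDifferentiableAt 𝓘(ℝ, E) 𝓘(ℝ, E') f x)
    (hg : MDifferentiableAt 𝓘(ℝ, E') 𝓘(ℝ, E'') g y) :
    modelDeriv E E'' (g ∘ f) x = (modelDeriv E' E'' g y).comp (modelDeriv E E' f x) := by
  subst hy
  exact mfderiv_comp x hg hf

theorem modelDeriv_congr {f g : M → M'} {x : M} (h : f =ᶠ[𝓝 x] g) :
    modelDeriv E E' f x = modelDeriv E E' g x :=
  h.mfderiv_eq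

theorem modelDeriv_eq_fderiv {f : E → E'} {x : E} : modelDeriv E E' f x = fderiv ℝ f x :=
  mfderiv_eq_fderiv

end ModelDeriv

/-- The adjoint action with `𝔤` identified with the model space. -/
noncomputable def modelAd (g : G) : F →L[ℝ] F :=
  Ad g

theorem modelDeriv_chartOne :
    modelDeriv F F (chartOne F G) 1 = ContinuousLinearMap.id ℝ F := by
  have : IsManifold 𝓘(ℝ, F) 1 G := IsManifold.of_le (n := ∞) (by simp)
  exact mfderiv_extChartAt_self

theorem mdifferentiableAt_chartOne {g : G} (hg : g ∈ (chartOne F G).source) :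
    MDifferentiableAt 𝓘(ℝ, F) 𝓘(ℝ, F) (chartOne F G) g :=
  mdifferentiableAt_extChartAt_of_mem hg

/-- If `φ` expresses `f` in the chart at the identity, then the derivative of `φ` expresses that
of `f`. -/
theorem modelDeriv_chartOne_comp {f : G → G} {q : G} (hq : f 1 = q)
    (hqs : q ∈ (chartOne F G).source) (hf : MDifferentiableAt 𝓘(ℝ, F) 𝓘(ℝ, F) f 1)
    {φ : F → F} {φ' : F →L[ℝ] F} (hφ : HasFDerivAt φ φ' (coordOne F G))
    (h : ∀ g ∈ (chartOne F G).source, chartOne F G (f g) = φ (chartOne F G g)) :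
    (modelDeriv F F (chartOne F G) q).comp (modelDeriv F F f 1) = φ' := by
  rw [← modelDeriv_comp hq hf (mdifferentiableAt_chartOne hqs)]
  have he : chartOne F G ∘ f =ᶠ[𝓝 1] φ ∘ chartOne F G :=
    Filter.eventually_of_mem (extChartAt_source_mem_nhds 1) h
  rw [modelDeriv_congr he, modelDeriv_comp (E := F) (E' := F) (E'' := F) (f := chartOne F G)
    (g := φ) (x := (1 : G)) (y := coordOne F G) rfl
    (mdifferentiableAt_chartOne one_mem_chartOne_source) hφ.differentiableAt.mdifferentiableAt,
    modelDeriv_chartOne, modelDeriv_eq_fderiv, hφ.fderiv]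
  rfl

theorem modelDeriv_eq_of_chartOne {f : G → G} (hq : f 1 = 1)
    (hf : MDifferentiableAt 𝓘(ℝ, F) 𝓘(ℝ, F) f 1)
    {φ : F → F} {φ' : F →L[ℝ] F} (hφ : HasFDerivAt φ φ' (coordOne F G))
    (h : ∀ g ∈ (chartOne F G).source, chartOne F G (f g) = φ (chartOne F G g)) :
    modelDeriv F F f 1 = φ' := by
  have := modelDeriv_chartOne_comp hq one_mem_chartOne_source hf hφ h
  rwa [modelDeriv_chartOne] at this

omit [LieGroup 𝓘(ℝ, F) ∞ G] in
theorem eventually_mem_chartOne_source : ∀ᶠ g : G in 𝓝 1, g ∈ (chartOne F G).source :=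
  extChartAt_source_mem_nhds 1

theorem modelAd_chartOne_symm {x : F} (hx : x ∈ (chartOne F G).target) :
    modelAd ((chartOne F G).symm x) = chartAd F G x := by
  refine modelDeriv_eq_of_chartOne (by simp) ((contMDiff_conj _).mdifferentiableAt (by simp))
    (hasFDerivAt_chartConj hx) fun h hh => ?_
  have e : (chartOne F G).symm (chartOne F G h) = h := (chartOne F G).left_inv hh
  rw [chartConj, e]

/-- In the chart at the identity, the left invariant vector field of `X` is
`x ↦ D₂m (x, 1) X`, where `m` is the multiplication. -/
theorem mpullback_mulInvariantVectorField_chartOne {x : F} (hx : x ∈ (chartOne F G).target)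
    (X : LieAlg F G) :
    (VectorField.mpullbackWithin 𝓘(ℝ, F) 𝓘(ℝ, F) (chartOne F G).symm
      (mulInvariantVectorField X) (Set.range 𝓘(ℝ, F)) x : F) =
      fderiv ℝ (chartMul F G) (x, coordOne F G) (0, X) := by
  have : IsManifold 𝓘(ℝ, F) 1 G := IsManifold.of_le (n := ∞) (by simp)
  have hp := ((contDiffAt_chartMul_right (G := G) hx).differentiableAt
    (by simp)).hasFDerivAt.partial_snd
  have h1 := modelDeriv_chartOne_comp (f := fun h : G => (chartOne F G).symm x * h)
    (mul_one _) ((chartOne F G).map_target hx) ((contMDiff_mulLeft _).mdifferentiableAt (by simp))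
    hp fun h hh => by
      have e : (chartOne F G).symm (chartOne F G h) = h := (chartOne F G).left_inv hh
      rw [chartMul, e]
  have h3 : fderiv ℝ (chartMul F G) (x, coordOne F G) (0, X) = _ :=
    (DFunLike.congr_fun h1 X).symm
  rw [h3, VectorField.mpullbackWithin_apply]
  have hinv := isInvertible_mfderivWithin_extChartAt_symm (I := 𝓘(ℝ, F)) (x := (1 : G)) hx
  refine (ContinuousLinearMap.IsInvertible.inverse_apply_eq hinv).2 ?_
  have h4 := mfderivWithin_extChartAt_symm_comp_mfderiv_extChartAt (I := 𝓘(ℝ, F))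
    (x := (1 : G)) hx
  exact (DFunLike.congr_fun h4 _).symm

/-- The Lie bracket is the antisymmetrisation of the second derivative of the multiplication in
the chart at the identity. -/
theorem bracket_eq_fderiv_chartMul (X Y : LieAlg F G) :
    (⁅X, Y⁆ : LieAlg F G) =
      (fderiv ℝ (fderiv ℝ (chartMul F G)) (coordOne F G, coordOne F G) (X, 0) (0, Y)
      - fderiv ℝ (fderiv ℝ (chartMul F G)) (coordOne F G, coordOne F G) (Y, 0) (0, X) : F) := by
  have : IsManifold 𝓘(ℝ, F) 1 G := IsManifold.of_le (n := ∞) (by simp)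
  set o := coordOne F G
  have hm : ContDiffAt ℝ ∞ (chartMul F G) (o, o) := contDiffAt_chartMul_left coordOne_mem_target
  have hm2 : HasFDerivAt (fderiv ℝ (chartMul F G)) (fderiv ℝ (fderiv ℝ (chartMul F G)) (o, o))
      (o, o) :=
    ((hm.fderiv_right (m := ∞) (by simp)).differentiableAt (by simp)).hasFDerivAt
  set V : LieAlg F G → F → F := fun X => VectorField.mpullbackWithin 𝓘(ℝ, F) 𝓘(ℝ, F)
    (chartOne F G).symm (mulInvariantVectorField X) (Set.range 𝓘(ℝ, F)) with hV
  have hVo : ∀ X : LieAlg F G, V X o = X := fun X =>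
    (mpullback_mulInvariantVectorField_chartOne coordOne_mem_target X).trans
      (fderiv_chartMul_right_apply (F := F) (G := G) X)
  have hVd : ∀ (X Z : F), fderiv ℝ (V X) o Z =
      fderiv ℝ (fderiv ℝ (chartMul F G)) (o, o) (Z, 0) (0, X) := fun X Z => by
    have h1 := hm2.partial_fst.clm_apply (hasFDerivAt_const ((0, X) : F × F) o)
    have h2 : V X =ᶠ[𝓝 o] fun x => fderiv ℝ (chartMul F G) (x, o) (0, X) := by
      filter_upwards [eventually_mem_chartOne_target] with x hx
      exact mpullback_mulInvariantVectorField_chartOne hx X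
    rw [h2.fderiv_eq, h1.fderiv]
    simp
  have hset : (chartOne F G).symm ⁻¹' Set.univ ∩ Set.range 𝓘(ℝ, F) = Set.univ := by simp
  have hb : (⁅X, Y⁆ : LieAlg F G) = (modelDeriv F F (chartOne F G) 1).inverse
      (VectorField.lieBracketWithin ℝ (V X) (V Y)
        ((chartOne F G).symm ⁻¹' Set.univ ∩ Set.range 𝓘(ℝ, F)) o) := rfl
  rw [hset, VectorField.lieBracketWithin_univ, modelDeriv_chartOne,
    ContinuousLinearMap.inverse_id] at hb
  refine hb.trans ?_
  change fderiv ℝ (V Y) o (V X o) - fderiv ℝ (V X) o (V Y o) = _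
  rw [hVo, hVo]
  exact congrArg₂ (fun u v : F => u - v) (hVd Y X) (hVd X Y)

variable [FiniteDimensional ℝ F]

/-- The derivative of the adjoint action at the identity is the Lie bracket. -/
theorem fderiv_chartAd_eq_ad (X : F) :
    fderiv ℝ (chartAd F G) (coordOne F G) X = (ad (F := F) (G := G) X : F →L[ℝ] F) := by
  ext Y
  rw [fderiv_chartAd]
  exact (bracket_eq_fderiv_chartMul (F := F) (G := G) X Y).symm

omit [FiniteDimensional ℝ F] in
theorem modelAd_mul (g h : G) : modelAd (F := F) (g * h) = (modelAd g).comp (modelAd h) := by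
  have h1 := modelDeriv_comp (E := F) (E' := F) (E'' := F) (f := fun x : G => h * x * h⁻¹)
    (g := fun x : G => g * x * g⁻¹) (x := 1) (y := 1) (by simp)
    ((contMDiff_conj h).mdifferentiableAt (by simp))
    ((contMDiff_conj g).mdifferentiableAt (by simp))
  refine Eq.trans ?_ h1
  have : (fun x : G => g * x * g⁻¹) ∘ (fun x : G => h * x * h⁻¹) =
      fun x : G => g * h * x * (g * h)⁻¹ := by
    ext x
    simp [mul_assoc]
  rw [this]
  rfl

omit [FiniteDimensional ℝ F] in
theorem modelAd_one : modelAd (F := F) (1 : G) = ContinuousLinearMap.id ℝ F := by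
  rw [← chartOne_symm_coordOne (F := F) (G := G), modelAd_chartOne_symm coordOne_mem_target,
    chartAd_coordOne]

omit [FiniteDimensional ℝ F] in
/-- Differentiating `g * g⁻¹ = 1` at the identity. -/
theorem modelDeriv_inv_one :
    modelDeriv F F (fun g : G => g⁻¹) 1 = -ContinuousLinearMap.id ℝ F := by
  set o := coordOne F G
  set i : F → F := fun x => chartOne F G ((chartOne F G).symm x)⁻¹ with hi
  have hinv : ContMDiff 𝓘(ℝ, F) 𝓘(ℝ, F) ∞ (fun g : G => g⁻¹) := contMDiff_inv 𝓘(ℝ, F) ∞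
  have hsymm : ContMDiffAt 𝓘(ℝ, F) 𝓘(ℝ, F) ∞ (fun x => ((chartOne F G).symm x)⁻¹) o :=
    ContMDiffAt.inv (contMDiffAt_extChartAt_symm_of_mem coordOne_mem_target)
  have hone : ((chartOne F G).symm o)⁻¹ = 1 := by
    rw [chartOne_symm_coordOne, inv_one]
  have hio : i o = o := by
    simp only [hi, hone]
    rfl
  have hid : HasFDerivAt i (fderiv ℝ i o) o := by
    have h1 : ((chartOne F G).symm o)⁻¹ ∈ (chartOne F G).source := by
      rw [hone]
      exact one_mem_chartOne_source
    have h2 : ContMDiffAt 𝓘(ℝ, F) 𝓘(ℝ, F) ∞ i o :=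
      ContMDiffAt.comp o (contMDiffAt_extChartAt_of_mem h1) hsymm
    exact (h2.contDiffAt.differentiableAt (by simp)).hasFDerivAt
  have hm : HasFDerivAt (chartMul F G) (fderiv ℝ (chartMul F G) (o, o)) (o, i o) := by
    rw [hio]
    exact ((contDiffAt_chartMul_left (G := G) coordOne_mem_target).differentiableAt
      (by simp)).hasFDerivAt
  have h3 : HasFDerivAt (fun x => chartMul F G (x, i x)) _ o :=
    HasFDerivAt.comp (g := chartMul F G) o hm ((hasFDerivAt_id o).prodMk hid)
  have h4 : (fun x => chartMul F G (x, i x)) =ᶠ[𝓝 o] fun _ => o := by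
    have hs : ∀ᶠ x in 𝓝 o, ((chartOne F G).symm x)⁻¹ ∈ (chartOne F G).source := by
      refine hsymm.continuousAt.preimage_mem_nhds
        ((isOpen_extChartAt_source (1 : G)).mem_nhds ?_)
      rw [hone]
      exact one_mem_chartOne_source
    filter_upwards [hs] with x hx
    have e : (chartOne F G).symm (i x) = _ := (chartOne F G).left_inv hx
    simp only [chartMul, e, mul_inv_cancel]
    rfl
  have h5 := h3.unique ((hasFDerivAt_const o o).congr_of_eventuallyEq h4)
  have h6 : fderiv ℝ i o = -ContinuousLinearMap.id ℝ F := by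
    ext X
    have h6 : fderiv ℝ (chartMul F G) (o, o) (X, fderiv ℝ i o X) = 0 := DFunLike.congr_fun h5 X
    have h7 : ((X, fderiv ℝ i o X) : F × F) = (X, 0) + (0, fderiv ℝ i o X) := by simp
    rw [h7, map_add, fderiv_chartMul_left_apply, fderiv_chartMul_right_apply] at h6
    exact (neg_eq_of_add_eq_zero_right h6).symm
  rw [← h6]
  refine modelDeriv_eq_of_chartOne inv_one (hinv.mdifferentiableAt (by simp)) hid fun h hh => ?_
  have e : (chartOne F G).symm (chartOne F G h) = h := (chartOne F G).left_inv hh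
  simp only [hi, e]

omit [FiniteDimensional ℝ F] in
/-- The adjoint action is differentiable at the identity with derivative `ad`. -/
theorem hasMFDerivAt_modelAd_one :
    HasMFDerivAt 𝓘(ℝ, F) 𝓘(ℝ, F →L[ℝ] F) (fun g : G => modelAd (F := F) g) 1
      (fderiv ℝ (chartAd F G) (coordOne F G)) := by
  have h1 : HasMFDerivAt 𝓘(ℝ, F) 𝓘(ℝ, F) (chartOne F G) 1 (modelDeriv F F (chartOne F G) 1) :=
    (mdifferentiableAt_chartOne (F := F) (G := G) one_mem_chartOne_source).hasMFDerivAt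
  rw [modelDeriv_chartOne] at h1
  have h2 : HasMFDerivAt 𝓘(ℝ, F) 𝓘(ℝ, F →L[ℝ] F) (chartAd F G) (chartOne F G 1)
      (fderiv ℝ (chartAd F G) (coordOne F G)) :=
    (differentiableAt_chartAd (F := F) (G := G)).hasFDerivAt.hasMFDerivAt
  refine (HasMFDerivAt.comp (1 : G) h2 h1).congr_of_eventuallyEq ?_
  filter_upwards [eventually_mem_chartOne_source (F := F)] with g hg
  have e : (chartOne F G).symm (chartOne F G g) = g := (chartOne F G).left_inv hg
  have h3 := modelAd_chartOne_symm ((chartOne F G).map_source hg)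
  rw [e] at h3
  exact h3

omit [FiniteDimensional ℝ F] in
theorem hasMFDerivAt_modelAd_inv_one :
    HasMFDerivAt 𝓘(ℝ, F) 𝓘(ℝ, F →L[ℝ] F) (fun g : G => modelAd (F := F) g⁻¹) 1
      (-fderiv ℝ (chartAd F G) (coordOne F G)) := by
  have hinv : ContMDiff 𝓘(ℝ, F) 𝓘(ℝ, F) ∞ (fun g : G => g⁻¹) := contMDiff_inv 𝓘(ℝ, F) ∞
  have h1 : HasMFDerivAt 𝓘(ℝ, F) 𝓘(ℝ, F) (fun g : G => g⁻¹) 1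
      (modelDeriv F F (fun g : G => g⁻¹) 1) :=
    (hinv.mdifferentiableAt (x := 1) (by simp)).hasMFDerivAt
  rw [modelDeriv_inv_one] at h1
  have h2 : HasMFDerivAt 𝓘(ℝ, F) 𝓘(ℝ, F →L[ℝ] F) (fun g : G => modelAd (F := F) g) (1 : G)⁻¹
      (fderiv ℝ (chartAd F G) (coordOne F G)) := by
    rw [inv_one]
    exact hasMFDerivAt_modelAd_one
  have h3 := HasMFDerivAt.comp (1 : G) h2 h1
  have e : (fderiv ℝ (chartAd F G) (coordOne F G)).comp (-ContinuousLinearMap.id ℝ F) =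
      -fderiv ℝ (chartAd F G) (coordOne F G) := by
    ext X Y
    simp
  exact h3.congr_mfderiv e

end Adjoint

/-! ### Invariance under a connected group -/

section LocallyConstant

variable {E : Type*} [NormedAddCommGroup E] [NormedSpace ℝ E]
  {M : Type*} [TopologicalSpace M] [ChartedSpace E M] [IsManifold 𝓘(ℝ, E) ∞ M]

/-- A function whose derivative vanishes everywhere is locally constant. -/
theorem isLocallyConstant_of_hasMFDerivAt_zero {f : M → ℝ}
    (h : ∀ p, HasMFDerivAt 𝓘(ℝ, E) 𝓘(ℝ, ℝ) f p (0 : E →L[ℝ] ℝ)) : IsLocallyConstant f := by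
  rw [IsLocallyConstant.iff_eventually_eq]
  intro p
  set c := extChartAt 𝓘(ℝ, E) p
  have hp : c p ∈ c.target := mem_extChartAt_target p
  have hd : ∀ y ∈ c.target, HasFDerivAt (f ∘ c.symm) (0 : E →L[ℝ] ℝ) y := fun y hy => by
    have h1 := (mdifferentiableAt_extChartAt_symm_of_mem hy).hasMFDerivAt
    have h2 := (HasMFDerivAt.comp y (h (c.symm y)) h1).hasFDerivAt
    exact h2.congr_fderiv (ContinuousLinearMap.zero_comp _)
  obtain ⟨r, hr, hball⟩ := Metric.mem_nhds_iff.1 (extChartAt_target_mem_nhds_of_mem hp)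
  have hc : ContinuousAt c p := continuousAt_extChartAt p
  filter_upwards [hc.preimage_mem_nhds (Metric.ball_mem_nhds (c p) hr),
    extChartAt_source_mem_nhds (I := 𝓘(ℝ, E)) p] with q hq hqs
  have hconst := (convex_ball (c p) r).is_const_of_fderivWithin_eq_zero (𝕜 := ℝ)
    (f := f ∘ c.symm) (fun y hy => (hd y (hball hy)).differentiableAt.differentiableWithinAt)
    (fun y hy => by
      rw [fderivWithin_of_isOpen Metric.isOpen_ball hy, (hd y (hball hy)).fderiv])
    hq (Metric.mem_ball_self hr)
  have e1 : c.symm (c q) = q := c.left_inv hqs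
  have e2 : c.symm (c p) = p := c.left_inv (mem_extChartAt_source p)
  simpa [e1, e2] using hconst

end LocallyConstant

section AdInvariance

variable {F : Type*} [NormedAddCommGroup F] [NormedSpace ℝ F] [FiniteDimensional ℝ F]
  {G : Type*} [TopologicalSpace G] [ChartedSpace F G] [Group G] [LieGroup 𝓘(ℝ, F) ∞ G]

/-- For `ad`-invariant `u`, the derivative of `g ↦ Ad_g u` vanishes at the identity. -/
theorem hasMFDerivAt_push_modelAd_one {k : ℕ} {u : Multivector k F}
    (hu : IsAdInvariant (F := F) (G := G) u) (ξ : Fin k → F →L[ℝ] ℝ) :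
    HasMFDerivAt 𝓘(ℝ, F) 𝓘(ℝ, ℝ)
      (fun g : G => u fun i => (ξ i).comp (modelAd (F := F) g)) 1 (0 : F →L[ℝ] ℝ) := by
  have h1 : HasMFDerivAt 𝓘(ℝ, F) 𝓘(ℝ, F →L[ℝ] F) (fun g : G => modelAd (F := F) g) 1
      (fderiv ℝ (chartAd F G) (coordOne F G)) := hasMFDerivAt_modelAd_one
  have h2 : HasFDerivAt (fun (A : F →L[ℝ] F) (i : Fin k) => (ξ i).comp A)
      (ContinuousLinearMap.pi fun i => ContinuousLinearMap.compL ℝ F F ℝ (ξ i))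
      (modelAd (F := F) (1 : G)) :=
    hasFDerivAt_pi.2 fun i => (ContinuousLinearMap.compL ℝ F F ℝ (ξ i)).hasFDerivAt
  have h3 : HasFDerivAt (fun ξ => u ξ)
      (u.toContinuousMultilinearMap.linearDeriv fun i => (ξ i).comp (modelAd (F := F) (1 : G)))
      (fun i => (ξ i).comp (modelAd (F := F) (1 : G))) :=
    u.toContinuousMultilinearMap.hasFDerivAt _
  have h4 := HasMFDerivAt.comp (1 : G) (h3.comp (modelAd (F := F) (1 : G)) h2).hasMFDerivAt h1
  refine h4.congr_mfderiv ?_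
  ext X
  have h5 := hu X ξ
  rw [← fderiv_chartAd_eq_ad (F := F) (G := G) X] at h5
  rw [modelAd_one]
  change u.toContinuousMultilinearMap.linearDeriv (fun i => (ξ i).comp _)
    (fun i => (ξ i).comp (fderiv ℝ (chartAd F G) (coordOne F G) X)) = 0
  rw [ContinuousMultilinearMap.linearDeriv_apply]
  exact h5

/-- On a connected group, `ad`-invariance implies `Ad`-invariance. -/
theorem IsAdInvariant.push_Ad [ConnectedSpace G] {k : ℕ} {u : Multivector k (LieAlg F G)}
    (hu : IsAdInvariant u) (g : G) : Multivector.push (Ad g) u = u := by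
  ext ξ
  set u' : Multivector k F := u
  -- as `Ad_g` is a homomorphism, the derivative at `g₀` reduces to that at the identity
  have hloc : IsLocallyConstant
      (fun g : G => u' fun i => (show F →L[ℝ] ℝ from ξ i).comp (modelAd (F := F) g)) := by
    refine isLocallyConstant_of_hasMFDerivAt_zero (E := F) fun g₀ => ?_
    have h1 := hasMFDerivAt_push_modelAd_one (F := F) (G := G) hu
      fun i => (show F →L[ℝ] ℝ from ξ i).comp (modelAd (F := F) g₀)
    have h2 : HasMFDerivAt 𝓘(ℝ, F) 𝓘(ℝ, F) (fun g : G => g₀⁻¹ * g) g₀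
        (modelDeriv F F (fun g : G => g₀⁻¹ * g) g₀) :=
      ((contMDiff_mulLeft (F := F) g₀⁻¹).mdifferentiableAt (by simp)).hasMFDerivAt
    have h3 := HasMFDerivAt.comp g₀ (by rw [inv_mul_cancel]; exact h1) h2
    refine (h3.congr_mfderiv (ContinuousLinearMap.zero_comp _)).congr_of_eventuallyEq ?_
    refine Filter.Eventually.of_forall fun g => ?_
    change _ = u' fun i => ((show F →L[ℝ] ℝ from ξ i).comp (modelAd (F := F) g₀)).comp
      (modelAd (F := F) (g₀⁻¹ * g))
    refine congrArg u' (funext fun i => ?_)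
    rw [ContinuousLinearMap.comp_assoc, ← modelAd_mul, mul_inv_cancel_left]
  have h := hloc.apply_eq_of_preconnectedSpace g 1
  simp only [modelAd_one] at h
  exact h

/-- `Ad`-invariant multivectors have equal left and right invariant extensions. -/
theorem IsAdInvariant.leftInv_eq_rightInv [ConnectedSpace G] {k : ℕ}
    {u : Multivector k (LieAlg F G)} (hu : IsAdInvariant u) (g : G) :
    leftInv u g = rightInv u g := by
  have h1 := push_mfderiv_comp (f := fun h : G => g * h * g⁻¹) (g := fun h : G => h * g) (x := 1)
    (y := 1) (by simp) ((contMDiff_conj (F := F) g).mdifferentiableAt (by simp))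
    ((contMDiff_mulRight (F := F) g).mdifferentiableAt (by simp)) u
  have h2 : (fun h : G => h * g) ∘ (fun h : G => g * h * g⁻¹) = fun h => g * h := by
    ext h
    simp
  have h3 : Multivector.push (mfderiv 𝓘(ℝ, F) 𝓘(ℝ, F) (fun h : G => g * h * g⁻¹) 1) u = u :=
    hu.push_Ad g
  rw [h2] at h1
  refine h1.symm.trans ?_
  exact congrArg (Multivector.push (mfderiv 𝓘(ℝ, F) 𝓘(ℝ, F) (fun h : G => h * g) 1)) h3

end AdInvariance

/-! ### Invariant and fundamental multivector fields -/

section Action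

variable {E : Type*} [NormedAddCommGroup E] [NormedSpace ℝ E]
  {M : Type*} [TopologicalSpace M] [ChartedSpace E M] [IsManifold 𝓘(ℝ, E) ∞ M]
  {F : Type*} [NormedAddCommGroup F] [NormedSpace ℝ F]
  {G : Type*} [TopologicalSpace G] [ChartedSpace F G] [Group G] [LieGroup 𝓘(ℝ, F) ∞ G]

/-- Left invariance: `L_{g*} u^L_h = u^L_{gh}`. -/
theorem leftInv_mul {k : ℕ} (u : Multivector k (LieAlg F G)) (g h : G) :
    leftInv u (g * h) =
      Multivector.push (mfderiv 𝓘(ℝ, F) 𝓘(ℝ, F) (fun x : G => g * x) h) (leftInv u h) := by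
  have h1 := push_mfderiv_comp (f := fun x : G => h * x) (g := fun x : G => g * x) (x := 1)
    (y := h) (mul_one h) ((contMDiff_mulLeft (F := F) h).mdifferentiableAt (by simp))
    ((contMDiff_mulLeft (F := F) g).mdifferentiableAt (by simp)) u
  have h2 : (fun x : G => g * x) ∘ (fun x : G => h * x) = fun x => g * h * x := by
    ext x
    simp [mul_assoc]
  rw [h2] at h1
  exact h1.symm

/-- For bivectors the inversion maps `t^L` to `t^R`, as `-1` acts trivially on `Λ²`. -/
theorem rightInv_inv {t : Multivector 2 (LieAlg F G)} (g : G) :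
    rightInv t g⁻¹ =
      Multivector.push (mfderiv 𝓘(ℝ, F) 𝓘(ℝ, F) (fun x : G => x⁻¹) g) (leftInv t g) := by
  have hinv : ContMDiff 𝓘(ℝ, F) 𝓘(ℝ, F) ∞ (fun x : G => x⁻¹) := contMDiff_inv 𝓘(ℝ, F) ∞
  have h1 := push_mfderiv_comp (f := fun x : G => g * x) (g := fun x : G => x⁻¹) (x := 1)
    (y := g) (mul_one g) ((contMDiff_mulLeft (F := F) g).mdifferentiableAt (by simp))
    (hinv.mdifferentiableAt (by simp)) t
  have h2 := push_mfderiv_comp (f := fun x : G => x⁻¹) (g := fun x : G => x * g⁻¹) (x := 1)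
    (y := 1) inv_one (hinv.mdifferentiableAt (by simp))
    ((contMDiff_mulRight (F := F) g⁻¹).mdifferentiableAt (by simp)) t
  have h3 : (fun x : G => x⁻¹) ∘ (fun x : G => g * x) =
      (fun x : G => x * g⁻¹) ∘ fun x : G => x⁻¹ := by
    ext x
    simp
  -- a bivector is invariant under `-id`, the derivative of the inversion at the identity
  have h4 : Multivector.push (mfderiv 𝓘(ℝ, F) 𝓘(ℝ, F) (fun x : G => x⁻¹) 1) t = t := by
    change Multivector.push (V := F) (W := F) (modelDeriv F F (fun x : G => x⁻¹) 1) t = t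
    rw [modelDeriv_inv_one]
    refine pair_ext (V := F →L[ℝ] ℝ) fun α β => ?_
    refine (Multivector.push_pair (V := F) (W := F) _ _ _ _).trans ?_
    rw [ContinuousLinearMap.comp_neg, ContinuousLinearMap.comp_neg, ContinuousLinearMap.comp_id,
      ContinuousLinearMap.comp_id, ← neg_one_smul ℝ α, ← neg_one_smul ℝ β]
    refine (map_pair_smul_left (V := F →L[ℝ] ℝ) _ _ _ _).trans ?_
    refine (congrArg _ (map_pair_smul_right (V := F →L[ℝ] ℝ) _ _ _ _)).trans ?_
    simp
  rw [h3] at h1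
  refine Eq.trans ?_ (h2.trans h1.symm)
  exact (congrArg (Multivector.push (mfderiv 𝓘(ℝ, F) 𝓘(ℝ, F) (fun x : G => x * g⁻¹) 1)) h4).symm

variable [MulAction G M] [ContMDiffSMul 𝓘(ℝ, F) 𝓘(ℝ, E) ∞ G M]

omit [IsManifold 𝓘(ℝ, E) ∞ M] [LieGroup 𝓘(ℝ, F) ∞ G] in
theorem contMDiff_smul_pair :
    ContMDiff (𝓘(ℝ, F).prod 𝓘(ℝ, E)) 𝓘(ℝ, E) ∞ fun z : G × M => z.1 • z.2 :=
  ContMDiffSMul.contMDiff_smul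

omit [IsManifold 𝓘(ℝ, E) ∞ M] [LieGroup 𝓘(ℝ, F) ∞ G] in
variable (E F) in
theorem contMDiff_orbitMap (p : M) : ContMDiff 𝓘(ℝ, F) 𝓘(ℝ, E) ∞ fun g : G => g • p :=
  contMDiff_smul_pair.comp (contMDiff_id.prodMk contMDiff_const)

omit [IsManifold 𝓘(ℝ, E) ∞ M] [LieGroup 𝓘(ℝ, F) ∞ G]
  [ContMDiffSMul 𝓘(ℝ, F) 𝓘(ℝ, E) ∞ G M] in
variable (E F) in
theorem contMDiff_translation [ContMDiffSMul 𝓘(ℝ, F) 𝓘(ℝ, E) ∞ G M] (g : G) :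
    ContMDiff 𝓘(ℝ, E) 𝓘(ℝ, E) ∞ fun p : M => g • p :=
  (contMDiff_smul_pair (F := F)).comp (contMDiff_const.prodMk contMDiff_id)

omit [IsManifold 𝓘(ℝ, E) ∞ M] in
/-- The orbit map of `p` sends `u^R` to `u_M`. -/
theorem fundamental_smul {k : ℕ} (u : Multivector k (LieAlg F G)) (g : G) (p : M) :
    fundamental E M u (g • p) =
      Multivector.push (mfderiv 𝓘(ℝ, F) 𝓘(ℝ, E) (fun h : G => h • p) g) (rightInv u g) := by
  have h1 := push_mfderiv_comp (f := fun x : G => x * g) (g := fun h : G => h • p) (x := 1)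
    (y := g) (one_mul g) ((contMDiff_mulRight (F := F) g).mdifferentiableAt (by simp))
    ((contMDiff_orbitMap E F p).mdifferentiableAt (by simp)) u
  have h2 : (fun h : G => h • p) ∘ (fun x : G => x * g) = fun x => x • (g • p) := by
    ext x
    simp [mul_smul]
  rw [h2] at h1
  exact h1.symm

omit [IsManifold 𝓘(ℝ, E) ∞ M] in
/-- The translation by `g` sends `u_M` at `p` to the image of `u^L` at `g` under the orbit map
of `p`. -/
theorem push_fundamental {k : ℕ} (u : Multivector k (LieAlg F G)) (g : G) (p : M) :
    Multivector.push (mfderiv 𝓘(ℝ, E) 𝓘(ℝ, E) (fun q : M => g • q) p) (fundamental E M u p) =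
      Multivector.push (mfderiv 𝓘(ℝ, F) 𝓘(ℝ, E) (fun h : G => h • p) g) (leftInv u g) := by
  have h1 := push_mfderiv_comp (E := F) (E' := E) (E'' := E) (f := fun h : G => h • p)
    (g := fun q : M => g • q) (x := 1)
    (y := p) (one_smul G p) ((contMDiff_orbitMap E F p).mdifferentiableAt (by simp))
    ((contMDiff_translation (G := G) E F g).mdifferentiableAt (by simp)) u
  have h2 := push_mfderiv_comp (f := fun h : G => g * h) (g := fun h : G => h • p) (x := 1)
    (y := g) (mul_one g) ((contMDiff_mulLeft (F := F) g).mdifferentiableAt (by simp))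
    ((contMDiff_orbitMap E F p).mdifferentiableAt (by simp)) u
  have h3 : (fun q : M => g • q) ∘ (fun h : G => h • p) =
      (fun h : G => h • p) ∘ fun h : G => g * h := by
    ext x
    simp [mul_smul]
  rw [h3] at h1
  exact h1.trans h2.symm

variable [FiniteDimensional ℝ E] [FiniteDimensional ℝ F]

theorem isSmooth_fundamental (t : Multivector 2 (LieAlg F G)) :
    (fundamental E M t).IsSmooth :=
  isSmooth_push_orbitMap contMDiff_smul_pair (one_smul G) t fun _ => rfl

omit [IsManifold 𝓘(ℝ, E) ∞ M] [FiniteDimensional ℝ E] in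
theorem isSmooth_rightInv (t : Multivector 2 (LieAlg F G)) : (rightInv t).IsSmooth :=
  isSmooth_push_orbitMap contMDiff_mul_pair one_mul t fun _ => rfl

theorem isSmooth_leftInv (t : Multivector 2 (LieAlg F G)) : (leftInv t).IsSmooth :=
  isSmooth_push_orbitMap (a := fun z : G × G => z.2 * z.1)
    (contMDiff_mul_pair.comp (contMDiff_snd.prodMk contMDiff_fst)) mul_one t fun _ => rfl

end Action

/-! ### The Schouten bracket of the deformation -/

section Fields

variable {E : Type*} [NormedAddCommGroup E] [NormedSpace ℝ E] [FiniteDimensional ℝ E]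
  {M : Type*} [TopologicalSpace M] [ChartedSpace E M]

omit [FiniteDimensional ℝ E] in
theorem MultivectorField.IsSmooth.sub {k : ℕ} {P Q : MultivectorField E M k} (hP : P.IsSmooth)
    (hQ : Q.IsSmooth) : MultivectorField.IsSmooth fun p => P p - Q p :=
  fun x₀ => (hP x₀).sub (hQ x₀)

omit [FiniteDimensional ℝ E] in
theorem MultivectorField.IsSmooth.neg {k : ℕ} {P : MultivectorField E M k} (hP : P.IsSmooth) :
    MultivectorField.IsSmooth fun p => -P p :=
  fun x₀ => (hP x₀).neg

theorem schoutenSelfE_neg (P : E → Multivector 2 E) (y : E) :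
    schoutenSelfE (fun y => -P y) y = schoutenSelfE P y := by
  have h1 : ∀ v, fderiv ℝ (fun y => -P y) y v = -fderiv ℝ P y v := fun v =>
    DFunLike.congr_fun (fderiv_fun_neg (𝕜 := ℝ) (E := E) (F := Multivector 2 E) (f := P)) v
  have h2 : ∀ α β γ : E →L[ℝ] ℝ, fderiv ℝ (fun y => -P y) y ((-P y).sharp α) ![β, γ] =
      fderiv ℝ P y ((P y).sharp α) ![β, γ] := fun α β γ => by
    rw [h1, Multivector.sharp_neg, map_neg]
    exact neg_neg _
  refine triple_ext fun α β γ => ?_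
  rw [schoutenSelfE_apply, schoutenSelfE_apply, h2, h2, h2]

theorem schoutenSelf_neg (P : MultivectorField E M 2) (p : M) :
    schoutenSelf (fun p => -P p) p = schoutenSelf P p :=
  congrArg (Multivector.push (V := E) (mfderiv 𝓘(ℝ, E) 𝓘(ℝ, E) (extChartAt 𝓘(ℝ, E) p).symm
    (extChartAt 𝓘(ℝ, E) p p))) (schoutenSelfE_neg (P.inChart p) _)

end Fields

section Group

variable {F : Type*} [NormedAddCommGroup F] [NormedSpace ℝ F] [FiniteDimensional ℝ F]
  {G : Type*} [TopologicalSpace G] [ChartedSpace F G] [Group G] [LieGroup 𝓘(ℝ, F) ∞ G]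

theorem schoutenSelf_leftInv (t : Multivector 2 (LieAlg F G)) (g : G) :
    schoutenSelf (leftInv t) g = leftInv (twistBracket t) g := by
  have h := schoutenSelf_related (contMDiff_mulLeft (F := F) g) (isSmooth_leftInv t)
    (isSmooth_leftInv t) (fun h => leftInv_mul t g h) 1
  rw [mul_one] at h
  exact h

/-- The inversion of `G` relates `t^L` to `t^R` and acts by `-1` on `Λ³ 𝔤`. -/
theorem schoutenSelf_rightInv_one (t : Multivector 2 (LieAlg F G)) :
    schoutenSelf (rightInv t) 1 = -twistBracket t := by
  have hinv : ContMDiff 𝓘(ℝ, F) 𝓘(ℝ, F) ∞ (fun x : G => x⁻¹) := contMDiff_inv 𝓘(ℝ, F) ∞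
  have h := schoutenSelf_related hinv (isSmooth_leftInv t) (isSmooth_rightInv t)
    (fun g => rightInv_inv g) 1
  rw [inv_one] at h
  refine h.trans ?_
  change Multivector.push (V := F) (W := F) (modelDeriv F F (fun x : G => x⁻¹) 1) (twistBracket t) =
    (-twistBracket t : Multivector 3 F)
  rw [modelDeriv_inv_one]
  refine triple_ext (V := F →L[ℝ] ℝ) fun α β γ => ?_
  refine (Multivector.push_triple (V := F) (W := F) _ _ _ _ _).trans ?_
  set b : Multivector 3 F := twistBracket t
  change b _ = -(b _)
  have e : ![α.comp (-ContinuousLinearMap.id ℝ F), β.comp (-ContinuousLinearMap.id ℝ F),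
      γ.comp (-ContinuousLinearMap.id ℝ F)] = fun i => (-1 : ℝ) • ![α, β, γ] i := by
    ext i
    fin_cases i <;> simp
  rw [e]
  refine (b.toMultilinearMap.map_smul_univ (fun _ => (-1 : ℝ)) _).trans ?_
  norm_num

end Group

section Deform

variable {E : Type*} [NormedAddCommGroup E] [NormedSpace ℝ E] [FiniteDimensional ℝ E]
  {M : Type*} [TopologicalSpace M] [ChartedSpace E M] [IsManifold 𝓘(ℝ, E) ∞ M]
  {F : Type*} [NormedAddCommGroup F] [NormedSpace ℝ F] [FiniteDimensional ℝ F]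
  {G : Type*} [TopologicalSpace G] [ChartedSpace F G] [Group G] [LieGroup 𝓘(ℝ, F) ∞ G]
  [MulAction G M] [ContMDiffSMul 𝓘(ℝ, F) 𝓘(ℝ, E) ∞ G M]

variable (G) in
/-- A multivector field on `M` is `G`-invariant if it is preserved by all translations. -/
def IsInvariant {k : ℕ} (P : MultivectorField E M k) : Prop :=
  ∀ (g : G) (p : M),
    P (g • p) = Multivector.push (mfderiv 𝓘(ℝ, E) 𝓘(ℝ, E) (fun q : M => g • q) p) (P p)

omit [FiniteDimensional ℝ E] [IsManifold 𝓘(ℝ, E) ∞ M] [FiniteDimensional ℝ F] in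
/-- The action map relates the product of `-t^R` and `P` to `P - t_M`. -/
theorem deform_smul {P : MultivectorField E M 2} (hP : IsInvariant G P)
    (t : Multivector 2 (LieAlg F G)) (g : G) (p : M) :
    deform P t (g • p) =
      Multivector.push (mfderiv 𝓘(ℝ, F) 𝓘(ℝ, E) (fun h : G => h • p) g) (-rightInv t g)
      + Multivector.push (mfderiv 𝓘(ℝ, E) 𝓘(ℝ, E) (fun q : M => g • q) p) (P p) := by
  have h1 : deform P t (g • p) = _ := congrArg₂ (fun a b => a - b) (hP g p) (fundamental_smul t g p)
  rw [h1, Multivector.push_neg]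
  exact sub_eq_neg_add (α := Multivector 2 (TangentSpace 𝓘(ℝ, E) (g • p))) _ _

omit [FiniteDimensional ℝ E] [IsManifold 𝓘(ℝ, E) ∞ M] [FiniteDimensional ℝ F] in
/-- The action map relates the product of `t^L - t^R` and `P - t_M` to `P - t_M`: the images of
`t^L` at `g` and of `t_M` at `p` cancel. -/
theorem deform_smul_eq_push_deform {P : MultivectorField E M 2} (hP : IsInvariant G P)
    (t : Multivector 2 (LieAlg F G)) (g : G) (p : M) :
    deform P t (g • p) =
      Multivector.push (mfderiv 𝓘(ℝ, E) 𝓘(ℝ, E) (fun q : M => g • q) p) (deform P t p)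
      + Multivector.push (mfderiv 𝓘(ℝ, F) 𝓘(ℝ, E) (fun h : G => h • p) g)
        ((leftInv t - rightInv t) g) := by
  have h1 : deform P t (g • p) = _ := congrArg₂ (fun a b => a - b) (hP g p) (fundamental_smul t g p)
  have h2 : Multivector.push (mfderiv 𝓘(ℝ, E) 𝓘(ℝ, E) (fun q : M => g • q) p) (deform P t p) = _ :=
    Multivector.push_sub _ _ _
  have h3 : Multivector.push (mfderiv 𝓘(ℝ, F) 𝓘(ℝ, E) (fun h : G => h • p) g)
        ((leftInv t - rightInv t) g) = _ :=
    Multivector.push_sub _ _ _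
  rw [h1, h2, h3, push_fundamental]
  exact (sub_add_sub_cancel (G := Multivector 2 (TangentSpace 𝓘(ℝ, E) (g • p))) _ _ _).symm

theorem isSmooth_deform {P : MultivectorField E M 2} (hP : P.IsSmooth)
    (t : Multivector 2 (LieAlg F G)) : (deform P t).IsSmooth :=
  hP.sub (isSmooth_fundamental t)

theorem schoutenSelf_deform_smul {P : MultivectorField E M 2} (hP : P.IsSmooth)
    (hinv : IsInvariant G P) (t : Multivector 2 (LieAlg F G)) (g : G) (p : M) :
    schoutenSelf (deform P t) (g • p) =
      Multivector.push (mfderiv 𝓘(ℝ, F) 𝓘(ℝ, E) (fun h : G => h • p) g)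
        (schoutenSelf (rightInv t) g)
      + Multivector.push (mfderiv 𝓘(ℝ, E) 𝓘(ℝ, E) (fun q : M => g • q) p) (schoutenSelf P p) := by
  rw [← schoutenSelf_neg (rightInv t)]
  exact schoutenSelf_related_prod (contMDiff_smul_pair (F := F) (E := E) (G := G) (M := M))
    (isSmooth_rightInv t).neg hP (isSmooth_deform hP t) (fun g p => deform_smul hinv t g p) g p

/-- For an invariant bivector field `P`, `[P - t_M, P - t_M] = [P, P] - [t, t]_M`. -/
theorem schoutenSelf_deform {P : MultivectorField E M 2} (hP : P.IsSmooth)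
    (hinv : IsInvariant G P) (t : Multivector 2 (LieAlg F G)) (p : M) :
    schoutenSelf (deform P t) p = schoutenSelf P p - fundamental E M (twistBracket t) p := by
  -- `1 • p = p` is not definitional, so the equation is read in the model space
  have h1 : ∀ (q : M) (X : Multivector 3 E), q = p → schoutenSelf (deform P t) q = X →
      schoutenSelf (deform P t) p = X := by
    rintro _ X rfl h
    exact h
  refine h1 _ _ (one_smul G p) ((schoutenSelf_deform_smul hP hinv t 1 p).trans ?_)
  have h2 : modelDeriv E E (fun q : M => (1 : G) • q) p = ContinuousLinearMap.id ℝ E := by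
    have : (fun q : M => (1 : G) • q) = id := by
      ext q
      simp
    rw [this]
    exact mfderiv_id
  set A : F →L[ℝ] E := modelDeriv F E (fun h : G => h • p) 1 with hA
  set B : E →L[ℝ] E := modelDeriv E E (fun q : M => (1 : G) • q) p with hB
  set S : Multivector 3 E := schoutenSelf P p
  set T : Multivector 3 F := twistBracket t
  have h3 : (schoutenSelf (rightInv t) (1 : G) : Multivector 3 F) = -T :=
    schoutenSelf_rightInv_one t
  set R : Multivector 3 F := schoutenSelf (rightInv t) (1 : G)
  have h4 : Multivector.push A R + Multivector.push B S = S - Multivector.push A T := by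
    rw [h3, h2, Multivector.push_neg]
    exact neg_add_eq_sub (α := Multivector 3 E) _ _
  exact h4

omit [IsManifold 𝓘(ℝ, E) ∞ M] [TopologicalSpace G] in
theorem isInvariant_inducedPoisson {w : FormField E M 2} (hw : IsSymplectic w)
    (hs : ∀ g : G, ContMDiff 𝓘(ℝ, E) 𝓘(ℝ, E) ∞ fun p : M => g • p) (hG : PreservesForm G w) :
    IsInvariant G (inducedPoisson w) := by
  intro g p
  set A : E →L[ℝ] E := modelDeriv E E (fun q : M => g • q) p
  set B : E →L[ℝ] E := modelDeriv E E (fun q : M => g⁻¹ • q) (g • p)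
  have hd : ∀ (g : G) (q : M), MDifferentiableAt 𝓘(ℝ, E) 𝓘(ℝ, E) (fun q : M => g • q) q :=
    fun g q => (hs g).mdifferentiableAt (by simp)
  have hcomp : ∀ (g h : G) (q : M), g * h = 1 →
      (modelDeriv E E (fun q : M => g • q) (h • q)).comp (modelDeriv E E (fun q : M => h • q) q) =
        ContinuousLinearMap.id ℝ E := fun g h q hgh => by
    have h1 : (fun q : M => g • q) ∘ (fun q : M => h • q) = id := by
      ext q
      simp [smul_smul, hgh]
    rw [← modelDeriv_comp (E := E) (E' := E) (E'' := E) rfl (hd h q) (hd g (h • q)), h1]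
    exact mfderiv_id
  have hBA : B.comp A = ContinuousLinearMap.id ℝ E := hcomp g⁻¹ g p (inv_mul_cancel g)
  have hAB : A.comp B = ContinuousLinearMap.id ℝ E := by
    have := hcomp g g⁻¹ (g • p) (mul_inv_cancel g)
    rwa [inv_smul_smul] at this
  set w₁ : E [⋀^Fin 2]→L[ℝ] ℝ := w p
  set w₂ : E [⋀^Fin 2]→L[ℝ] ℝ := w (g • p)
  have h1 : w₂.compContinuousLinearMap A = w₁ := hG g p
  have h2 : w₁.compContinuousLinearMap B = w₂ := by
    ext v
    rw [← h1]
    change w₂ (A ∘ B ∘ v) = w₂ v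
    congr 1
    ext i
    exact DFunLike.congr_fun hAB (v i)
  have h3 : Multivector.push A (inducedBivector w₁) = inducedBivector w₂ := by
    have h4 : (flat w₁).IsInvertible := hw.isInvertible_flat p
    rw [push_inducedBivector h4 (DFunLike.congr_fun hAB) (DFunLike.congr_fun hBA), h2]
  exact h3.symm

/-- The deformation of an invariant Poisson structure by a twist `t` with `[t, t]_M = 0`. -/
theorem isPoisson_deform {P : MultivectorField E M 2} (hP : IsPoisson P)
    (hinv : IsInvariant G P) {t : Multivector 2 (LieAlg F G)}
    (ht : ∀ p, fundamental E M (twistBracket t) p = 0) : IsPoisson (deform P t) := by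
  refine ⟨isSmooth_deform hP.smooth t, fun p => ?_⟩
  rw [schoutenSelf_deform hP.smooth hinv, hP.schouten_eq_zero, ht]
  exact sub_zero (G := Multivector 3 (TangentSpace 𝓘(ℝ, E) p)) _

/-- `t^L - t^R` is the deformation of the bivector field `t^L` for the action of `G` on itself by
left translations, whose fundamental fields are right invariant. Its Schouten bracket is
`[t, t]^L - [t, t]^R`, which vanishes for an r-matrix. -/
theorem IsRMatrix.isPoissonLieGroup [ConnectedSpace G] {t : Multivector 2 (LieAlg F G)}
    (ht : IsRMatrix t) : IsPoissonLieGroup (leftInv t - rightInv t) := by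
  have hinv : IsInvariant G (leftInv t) := leftInv_mul t
  refine ⟨⟨isSmooth_deform (isSmooth_leftInv t) t, fun g => ?_⟩, fun g h => ?_⟩
  · refine (schoutenSelf_deform (isSmooth_leftInv t) hinv t g).trans ?_
    have h1 : schoutenSelf (leftInv t) g = rightInv (twistBracket t) g :=
      (schoutenSelf_leftInv t g).trans (IsAdInvariant.leftInv_eq_rightInv ht g)
    rw [h1]
    exact sub_self (G := Multivector 3 (TangentSpace 𝓘(ℝ, F) g)) _
  · exact deform_smul_eq_push_deform hinv t g h

theorem isPoissonAction_deform [ConnectedSpace G] {P : MultivectorField E M 2} (hP : IsPoisson P)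
    (hinv : IsInvariant G P) {t : Multivector 2 (LieAlg F G)}
    (ht : ∀ p, fundamental E M (twistBracket t) p = 0) (htr : IsRMatrix t) :
    IsPoissonAction (leftInv t - rightInv t) (deform P t) := by
  exact ⟨htr.isPoissonLieGroup, isPoisson_deform hP hinv ht, deform_smul_eq_push_deform hinv t⟩

end Deform

/-! ### Nondegeneracy of the deformation -/

section LinearAlgebra

variable {V W : Type*}
  [AddCommGroup V] [Module ℝ V] [TopologicalSpace V] [IsTopologicalAddGroup V]
  [ContinuousSMul ℝ V] [T2Space V] [FiniteDimensional ℝ V]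
  [AddCommGroup W] [Module ℝ W] [TopologicalSpace W] [IsTopologicalAddGroup W]
  [ContinuousSMul ℝ W] [T2Space W] [FiniteDimensional ℝ W]

/-- With `π♯ = (w♭)⁻¹`, the map `w♭ (π - Λ²ρ t)♯` is `1 - a b` for `a = w♭ ρ t♯` and `b = ρ*`, and
the hypothesis says that `1 - b a` is injective. -/
theorem nondegenerate_inducedBivector_sub_push {w : V [⋀^Fin 2]→L[ℝ] ℝ}
    (hw : (flat w).IsInvertible) (ρ : W →L[ℝ] V) (t : Multivector 2 W)
    (h : Function.Injective fun ξ : W →L[ℝ] ℝ => ξ - (flat w (ρ (t.sharp ξ))).comp ρ) :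
    (inducedBivector w - Multivector.push ρ t).Nondegenerate := by
  have h1 := injective_id_sub_comp ((flat w).toLinearMap ∘ₗ ρ.toLinearMap ∘ₗ t.sharp)
    (ρ.precomp ℝ).toLinearMap h
  have hinj : Function.Injective (inducedBivector w - Multivector.push ρ t).sharp := by
    refine Function.Injective.of_comp (f := flat w) ?_
    convert! h1 using 2 with α
    change flat w _ = α - flat w (ρ (t.sharp (α.comp ρ)))
    rw [Multivector.sharp_sub, Multivector.sharp_push, map_sub, flat_sharp_inducedBivector hw]
  refine ⟨hinj, ?_⟩
  refine (LinearMap.injective_iff_surjective_of_finrank_eq_finrank ?_).1 hinj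
  exact ((LinearMap.toContinuousLinearMap (𝕜 := ℝ) (E := V) (F' := ℝ)).finrank_eq.symm).trans
    Subspace.dual_finrank_eq

end LinearAlgebra

section Dressing

variable {F : Type*} [NormedAddCommGroup F] [NormedSpace ℝ F] [FiniteDimensional ℝ F]
  {G : Type*} [TopologicalSpace G] [ChartedSpace F G] [Group G] [LieGroup 𝓘(ℝ, F) ∞ G]

/-- The infinitesimal dressing action is `(X, ξ) ↦ ξ + ad*_X s` with `ad*_X s = -s ∘ ad_X`. -/
theorem infinitesimalDressing_apply (s : LieDual F G) (X : LieAlg F G) (ξ : LieDual F G) :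
    infinitesimalDressing s (X, ξ) = ξ - s.comp (ad X) := by
  set s' : F →L[ℝ] ℝ := s
  have h1 : HasMFDerivAt (𝓘(ℝ, F).prod 𝓘(ℝ, F →L[ℝ] ℝ)) 𝓘(ℝ, F →L[ℝ] F)
      (fun a : G × (F →L[ℝ] ℝ) => modelAd (F := F) a.1⁻¹) (1, 0)
      ((-fderiv ℝ (chartAd F G) (coordOne F G)).comp
        (ContinuousLinearMap.fst ℝ F (F →L[ℝ] ℝ))) :=
    HasMFDerivAt.comp (M' := G) (f := Prod.fst) (g := fun g : G => modelAd (F := F) g⁻¹)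
      ((1, 0) : G × (F →L[ℝ] ℝ)) hasMFDerivAt_modelAd_inv_one (hasMFDerivAt_fst _)
  have h2 : HasMFDerivAt (𝓘(ℝ, F).prod 𝓘(ℝ, F →L[ℝ] ℝ)) 𝓘(ℝ, F →L[ℝ] ℝ)
      (fun a : G × (F →L[ℝ] ℝ) => s'.comp (modelAd (F := F) a.1⁻¹)) (1, 0)
      ((ContinuousLinearMap.compL ℝ F F ℝ s').comp
        ((-fderiv ℝ (chartAd F G) (coordOne F G)).comp
          (ContinuousLinearMap.fst ℝ F (F →L[ℝ] ℝ)))) :=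
    HasMFDerivAt.comp ((1, 0) : G × (F →L[ℝ] ℝ))
      (ContinuousLinearMap.compL ℝ F F ℝ s').hasFDerivAt.hasMFDerivAt h1
  have h3 := (hasMFDerivAt_snd (I := 𝓘(ℝ, F)) (I' := 𝓘(ℝ, F →L[ℝ] ℝ))
    ((1, 0) : G × (F →L[ℝ] ℝ))).add h2
  have h4 : infinitesimalDressing s (X, ξ) = _ := DFunLike.congr_fun h3.mfderiv (X, ξ)
  have h5 := fderiv_chartAd_eq_ad (F := F) (G := G) X
  refine h4.trans ?_
  let ξ' : F →L[ℝ] ℝ := ξ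
  have h6 : ξ' + s'.comp ((-fderiv ℝ (chartAd F G) (coordOne F G)) X) =
      ξ' - s'.comp (fderiv ℝ (chartAd F G) (coordOne F G) X) := by
    ext Y
    exact (congrArg (fun r => ξ' Y + r) (s'.map_neg _)).trans (sub_eq_add_neg _ _).symm
  exact h6.trans (congrArg (fun A : F →L[ℝ] F => ξ' - s'.comp A) h5)

theorem IsAdmissibleAt.injective {t : Multivector 2 (LieAlg F G)} {s : LieDual F G}
    (h : IsAdmissibleAt t s) :
    Function.Injective fun ξ : LieDual F G => ξ - s.comp (ad (t.sharp ξ)) := by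
  intro ξ η hξη
  have hm : ∀ ξ : LieDual F G, (t.sharp ξ, ξ) ∈ twistedComplement t := fun ξ => ⟨ξ, rfl⟩
  have h1 := h.1 (a₁ := ⟨_, hm ξ⟩) (a₂ := ⟨_, hm η⟩) (by
    change infinitesimalDressing s (t.sharp ξ, ξ) = infinitesimalDressing s (t.sharp η, η)
    rw [infinitesimalDressing_apply, infinitesimalDressing_apply]
    exact hξη)
  exact (Prod.ext_iff.1 (Subtype.ext_iff.1 h1)).2

/-- The operator `ξ ↦ ξ - s' ∘ ad (t♯ ξ)` depends continuously on `(t, s')` and is the identity at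
`(0, s)`, hence invertible nearby. -/
theorem eventually_injective_sub_coad (s : LieDual F G) :
    ∀ᶠ z : Multivector 2 (LieAlg F G) × LieDual F G in 𝓝 (0, s),
      Function.Injective fun ξ : LieDual F G => ξ - z.2.comp (ad (z.1.sharp ξ)) := by
  set D : F →L[ℝ] F →L[ℝ] F := fderiv ℝ (chartAd F G) (coordOne F G)
  set K : Multivector 2 F × (F →L[ℝ] ℝ) → (F →L[ℝ] ℝ) →L[ℝ] (F →L[ℝ] ℝ) := fun z =>
    ContinuousLinearMap.id ℝ _ -
      ((ContinuousLinearMap.compL ℝ F F ℝ z.2).comp D).comp (sharpCLM F z.1) with hK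
  have hc : Continuous K := by
    have h1 : Continuous fun z : Multivector 2 F × (F →L[ℝ] ℝ) => sharpCLM F z.1 :=
      (sharpCLM F).continuous.comp continuous_fst
    have h2 : Continuous fun z : Multivector 2 F × (F →L[ℝ] ℝ) =>
        ContinuousLinearMap.compL ℝ F F ℝ z.2 :=
      (ContinuousLinearMap.compL ℝ F F ℝ).continuous.comp continuous_snd
    exact continuous_const.sub ((h2.clm_comp continuous_const).clm_comp h1)
  have h0 : IsUnit (K (0, s)) := by
    have : K (0, s) = 1 := by
      simp only [hK, map_zero, ContinuousLinearMap.comp_zero]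
      exact sub_zero (G := (F →L[ℝ] ℝ) →L[ℝ] (F →L[ℝ] ℝ)) _
    rw [this]
    exact isUnit_one
  have h1 : ∀ᶠ z in 𝓝 ((0, s) : Multivector 2 F × (F →L[ℝ] ℝ)), IsUnit (K z) :=
    hc.continuousAt.preimage_mem_nhds
      ((Units.isOpen (R := (F →L[ℝ] ℝ) →L[ℝ] (F →L[ℝ] ℝ))).mem_nhds h0)
  refine Filter.Eventually.mono h1 fun z hz => ?_
  obtain ⟨u, hu⟩ := hz
  have h2 : Function.Injective (K z) := by
    rw [← hu]
    refine Function.LeftInverse.injective (g := (↑u⁻¹ : (F →L[ℝ] ℝ) →L[ℝ] (F →L[ℝ] ℝ))) fun ξ => ?_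
    exact DFunLike.congr_fun u.inv_mul ξ
  intro ξ η h
  refine h2 ?_
  let s' : F →L[ℝ] ℝ := z.2
  have h3 : ∀ ξ : F →L[ℝ] ℝ, (fun A : F →L[ℝ] F => ξ - s'.comp A) (D (sharpCLM F z.1 ξ)) =
      (fun A : F →L[ℝ] F => ξ - s'.comp A) (ad (F := F) (G := G) (sharpCLM F z.1 ξ)) := fun ξ =>
    congrArg (fun A : F →L[ℝ] F => ξ - s'.comp A) (fderiv_chartAd_eq_ad (F := F) (G := G) _)
  exact (h3 ξ).trans (h.trans (h3 η).symm)

end Dressing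

section MomentMap

variable {E : Type*} [NormedAddCommGroup E] [NormedSpace ℝ E] [FiniteDimensional ℝ E]
  {M : Type*} [TopologicalSpace M] [ChartedSpace E M] [IsManifold 𝓘(ℝ, E) ∞ M]
  {F : Type*} [NormedAddCommGroup F] [NormedSpace ℝ F] [FiniteDimensional ℝ F]
  {G : Type*} [TopologicalSpace G] [ChartedSpace F G] [Group G] [LieGroup 𝓘(ℝ, F) ∞ G]
  [MulAction G M] [ContMDiffSMul 𝓘(ℝ, F) 𝓘(ℝ, E) ∞ G M]
  {w : FormField E M 2} {μ : M → LieDual F G}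

omit [FiniteDimensional ℝ E] [IsManifold 𝓘(ℝ, E) ∞ M] in
/-- Infinitesimal equivariance of the moment map: the derivative at `g = 1` of
`⟨μ (g • p), X⟩ = ⟨μ p, Ad_{g⁻¹} X⟩` in the direction `Y`. -/
theorem IsMomentMap.form_infinitesimalAction (hμ : IsMomentMap w μ) (p : M) (X Y : LieAlg F G) :
    w p ![infinitesimalAction p X, infinitesimalAction p Y] = μ p (ad X Y) := by
  let s : F →L[ℝ] ℝ := μ p
  let X' : F := X
  have h1 := modelDeriv_comp (E := F) (E' := E) (E'' := ℝ) (f := fun g : G => g • p)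
    (g := fun q => μ q X) (x := 1) (y := p) (one_smul G p)
    ((contMDiff_orbitMap E F p).mdifferentiableAt (by simp))
    ((hμ.smooth X).mdifferentiableAt (by simp))
  have h2 : (fun q => μ q X) ∘ (fun g : G => g • p) = fun g => s (modelAd (F := F) g⁻¹ X') := by
    ext g
    change μ (g • p) X = _
    rw [hμ.equivariant]
    rfl
  have h3 : HasMFDerivAt 𝓘(ℝ, F) 𝓘(ℝ, ℝ) (fun g : G => s (modelAd (F := F) g⁻¹ X')) 1
      ((s.comp (ContinuousLinearMap.apply ℝ F X')).comp
        (-fderiv ℝ (chartAd F G) (coordOne F G))) :=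
    HasMFDerivAt.comp (g := fun A : F →L[ℝ] F => s (A X'))
      (f := fun g : G => modelAd (F := F) g⁻¹) (1 : G)
      (s.comp (ContinuousLinearMap.apply ℝ F X')).hasFDerivAt.hasMFDerivAt
      hasMFDerivAt_modelAd_inv_one
  have h4 : modelDeriv F ℝ (fun g : G => s (modelAd (F := F) g⁻¹ X')) 1 = _ := h3.mfderiv
  rw [h2, h4] at h1
  have h5 : s (-fderiv ℝ (chartAd F G) (coordOne F G) Y X) = w p ![_, _] :=
    (DFunLike.congr_fun h1 Y).trans (hμ.hamiltonian X p (infinitesimalAction p Y))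
  refine h5.symm.trans (congrArg s ?_)
  have h6 : fderiv ℝ (chartAd F G) (coordOne F G) Y X' = (⁅Y, X⁆ : LieAlg F G) :=
    DFunLike.congr_fun (fderiv_chartAd_eq_ad (F := F) (G := G) Y) X'
  have h7 : (-⁅Y, X⁆ : LieAlg F G) = ⁅X, Y⁆ := by
    rw [bracket_eq_fderiv_chartMul, bracket_eq_fderiv_chartMul]
    exact neg_sub (α := F) _ _
  exact (congrArg (fun x : F => -x) h6).trans h7

omit [IsManifold 𝓘(ℝ, E) ∞ M] in
theorem IsMomentMap.flat_comp_infinitesimalAction (hμ : IsMomentMap w μ) (p : M) (X : LieAlg F G) :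
    (flat (w p) (infinitesimalAction p X)).comp (infinitesimalAction p) = (μ p).comp (ad X) := by
  ext Y
  exact hμ.form_infinitesimalAction p X Y

theorem IsMomentMap.isNondegenerate_deform (hμ : IsMomentMap w μ) (hw : IsSymplectic w)
    {t : Multivector 2 (LieAlg F G)}
    (ht : ∀ p, Function.Injective fun ξ : LieDual F G => ξ - (μ p).comp (ad (t.sharp ξ))) :
    IsNondegenerate (deform (inducedPoisson w) t) := by
  refine ⟨isSmooth_deform hw.isPoisson.smooth t, fun p => ?_⟩
  refine nondegenerate_inducedBivector_sub_push (hw.isInvertible_flat p)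
    (infinitesimalAction p) t ?_
  convert! ht p using 3
  exact hμ.flat_comp_infinitesimalAction p _

omit [FiniteDimensional ℝ E] [IsManifold 𝓘(ℝ, E) ∞ M] [LieGroup 𝓘(ℝ, F) ∞ G]
  [ContMDiffSMul 𝓘(ℝ, F) 𝓘(ℝ, E) ∞ G M] in
theorem IsMomentMap.continuous (hμ : IsMomentMap w μ) : Continuous μ :=
  continuous_clm_apply (E := F) (F := ℝ) (f := μ) |>.2 fun X => (hμ.smooth X).continuous

theorem IsMomentMap.eventually_isNondegenerate_deform [CompactSpace M] (hμ : IsMomentMap w μ)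
    (hw : IsSymplectic w) :
    ∀ᶠ t : Multivector 2 (LieAlg F G) in 𝓝 0, IsNondegenerate (deform (inducedPoisson w) t) := by
  have h := isCompact_univ.eventually_forall_of_forall_eventually
    (x₀ := (0 : Multivector 2 (LieAlg F G))) (K := (Set.univ : Set M))
    (P := fun t p => Function.Injective fun ξ : LieDual F G => ξ - (μ p).comp (ad (t.sharp ξ)))
    fun p _ => by
      have hc : Continuous fun z : Multivector 2 (LieAlg F G) × M => (z.1, μ z.2) :=
        continuous_fst.prodMk (hμ.continuous.comp continuous_snd)
      exact (hc.tendsto (0, p)).eventually (eventually_injective_sub_coad (μ p))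
  filter_upwards [h] with t ht
  exact hμ.isNondegenerate_deform hw fun p => ht p (Set.mem_univ p)

end MomentMap

end TwistDeformation

theorem mainTheorem1
    {E : Type*} [NormedAddCommGroup E] [NormedSpace ℝ E] [FiniteDimensional ℝ E]
    {M : Type*} [TopologicalSpace M] [ChartedSpace E M] [IsManifold 𝓘(ℝ, E) ∞ M]
    [T2Space M] [SecondCountableTopology M]
    {F : Type*} [NormedAddCommGroup F] [NormedSpace ℝ F] [FiniteDimensional ℝ F]
    {G : Type*} [TopologicalSpace G] [ChartedSpace F G] [Group G] [LieGroup 𝓘(ℝ, F) ∞ G]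
    [T2Space G] [SecondCountableTopology G] [ConnectedSpace G]
    [MulAction G M] [ContMDiffSMul 𝓘(ℝ, F) 𝓘(ℝ, E) ∞ G M]
    (w : FormField E M 2) (hw : IsSymplectic w) (hG : PreservesForm G w)
    (μ : M → LieDual F G) (hμ : IsMomentMap w μ) :
    -- (i)
    (∀ t : Multivector 2 (LieAlg F G), (∀ p : M, fundamental E M (twistBracket t) p = 0) →
      IsPoisson (deform (inducedPoisson w) t) ∧
      (IsRMatrix t →
        IsPoissonAction (leftInv t - rightInv t) (deform (inducedPoisson w) t))) ∧
    -- (ii)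
    (∀ t : Multivector 2 (LieAlg F G), (∀ p : M, IsAdmissibleAt t (μ p)) →
      IsNondegenerate (deform (inducedPoisson w) t)) ∧
    (CompactSpace M → ∀ᶠ t : Multivector 2 (LieAlg F G) in 𝓝 0,
      IsNondegenerate (deform (inducedPoisson w) t) ∧
      ((∀ p : M, fundamental E M (twistBracket t) p = 0) →
        ∃! w' : FormField E M 2,
          IsSymplectic w' ∧ inducedPoisson w' = deform (inducedPoisson w) t)) ∧
    -- both (i) and (ii)
    (∀ t : Multivector 2 (LieAlg F G), (∀ p : M, fundamental E M (twistBracket t) p = 0) →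
      (∀ p : M, IsAdmissibleAt t (μ p)) →
      ∃! w' : FormField E M 2,
        IsSymplectic w' ∧ inducedPoisson w' = deform (inducedPoisson w) t) := by
  have hπ := hw.isPoisson
  have hinv : IsInvariant G (inducedPoisson w) :=
    isInvariant_inducedPoisson hw (fun g => contMDiff_translation E F g) hG
  have hex : ∀ t : Multivector 2 (LieAlg F G), (∀ p : M, fundamental E M (twistBracket t) p = 0) →
      IsNondegenerate (deform (inducedPoisson w) t) →
      ∃! w' : FormField E M 2, IsSymplectic w' ∧ inducedPoisson w' = deform (inducedPoisson w) t :=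
    fun t ht hn => existsUnique_isSymplectic (isPoisson_deform hπ hinv ht) hn.nondegenerate
  have hadm : ∀ t : Multivector 2 (LieAlg F G), (∀ p : M, IsAdmissibleAt t (μ p)) →
      IsNondegenerate (deform (inducedPoisson w) t) := fun t ht =>
    hμ.isNondegenerate_deform hw fun p => (ht p).injective
  refine ⟨fun t ht => ⟨isPoisson_deform hπ hinv ht, isPoissonAction_deform hπ hinv ht⟩, hadm,
    fun _ => ?_, fun t ht ha => hex t ht (hadm t ha)⟩
  filter_upwards [hμ.eventually_isNondegenerate_deform hw] with t hn
  exact ⟨hn, fun ht => hex t ht hn⟩
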